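/- Let $D\subset S^2$ be a standard diagram of an alternating pseudo-Montesinos link: a reduced alternating link diagram on the projection sphere containing four pairwise disjoint disks, whose parts of $D$ are diagrams of rational $2$-string tangles $T_1,T_2,T_3,T_4$ with at least one crossing each, such that exactly two crossings $x,y$ of $D$ lie outside the four disks, and such that, outside the disks, $D$ consists of one strand without crossings joining $T_i$ to $T_{i+1}$ for each $i$ (indices mod $4$), two strands joining $T_1$ to $T_3$ and two strands joining $T_2$ to $T_4$; at each of $x$ and $y$ one strand of the first pair crosses one of the second pair, and the four ends of $T_i$ lead, in cyclic order, to $T_{i-1}$, $x$, $T_{i+1}$, $y$. (An alternating tangle diagram is rational if it consists of a two-string tangle diagram without crossings, surrounded by finitely many annuli, each of which meets $D$ in four arcs joining distinct boundary components of the annulus, with a single crossing between two of them.) Let $Q_i$ be the boundary curve of the disk of $T_i$. A PPPP curve in $D$ is a simple closed curve on $S^2$ that meets $D$ transversally in exactly four points, none of them a crossing; capping it off with a disk on each side of the projection sphere gives its associated $4$-punctured sphere. A strong isotopy rel $D$ of this sphere is an isotopy induced by a planar isotopy of the curve through PPPP curves. A PPPP curve $c'$ is a flyping curve if there is a PPPP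 curve $b$ disjoint from $c'$ such that the annulus between $c'$ and $b$ contains exactly one crossing of $D$ and the disk bounded by $b$ that is disjoint from $c'$ contains at least one crossing of $D$. Let $c$ be any PPPP curve in $D$ and let $W$ be its associated $4$-punctured sphere. Then there is a strong isotopy of $W$ rel $D$ that moves $c$ to a PPPP curve $c'$ for which at least one of the following holds: 1. $c'$ is parallel to $Q_i$ for some $i$; 2. $c'$ lies completely inside $T_i$ for some $i$; 3. $c'$ bounds a disk containing a single crossing of $D$, which is one of the two crossings exterior to $\bigcup_i T_i$, and $c'$ is not a flyping curve for $D$; 4. $c'$ bounds a disk containing no crossing of $D$ (a $2$-string tangle without crossings). -/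

import Mathlib

/-!
# Link diagrams on the sphere and curves that meet them in four points

A connected link diagram on the projection sphere is encoded by its combinatorial map: a finite set
of half-edges (darts), the rotation at the crossings, the involution that exchanges the two halves
of an edge, and the over/under information. The complementary regions (faces) of a connected
diagram on the sphere are open disks, so an arc inside a face that joins two boundary points of
that face is determined, up to isotopy of the face rel boundary, by its end points. Therefore a
closed curve transverse to the diagram is given by the points in which it meets the edges,
with real coordinates along the edges, and by the chords of the faces that join them.
-/

/-- A connected link diagram on the (oriented) sphere, with set `δ` of darts. A dart is an edge of
the diagram together with the choice of one of its ends; it points away from the crossing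
at that end. -/
structure LinkDiagram (δ : Type*) where
  /-- the next dart at the same crossing, in counterclockwise order -/
  rot : Equiv.Perm δ
  /-- the same edge, seen from its other end -/
  opp : Equiv.Perm δ
  /-- whether the strand that contains the dart passes over at the crossing of the dart -/
  isOver : δ → Bool
  /-- every crossing is four-valent -/
  rot_four : ∀ d, rot (rot (rot (rot d))) = d
  rot_rot_ne : ∀ d, rot (rot d) ≠ d
  opp_opp : ∀ d, opp (opp d) = d
  opp_ne : ∀ d, opp d ≠ d
  /-- of the two strands at a crossing one passes over the other -/
  isOver_rot : ∀ d, isOver (rot d) = !(isOver d)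
  connected : ∀ d e, ∃ g ∈ Subgroup.closure {rot, opp}, g d = e
  /-- The surface carrying the diagram is a sphere: crossings are the cycles of `rot`, edges
  the cycles of `opp`, faces the cycles of `opp` followed by `rot`. -/
  euler : Nat.card (Quotient (Equiv.Perm.SameCycle.setoid rot))
      + Nat.card (Quotient (Equiv.Perm.SameCycle.setoid (rot * opp)))
    = Nat.card (Quotient (Equiv.Perm.SameCycle.setoid opp)) + 2

namespace LinkDiagram

variable {δ : Type*} (D : LinkDiagram δ)

/-- The crossings of the diagram. -/
def Crossing : Type _ := Quotient (Equiv.Perm.SameCycle.setoid D.rot)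

/-- The crossing from which a dart points away. -/
def crossing (d : δ) : D.Crossing := Quotient.mk (Equiv.Perm.SameCycle.setoid D.rot) d

/-- The next dart along the boundary of the face to the right of a dart. The face to the
right of `d` is the cycle of `d` under this permutation. -/
def faceNext : Equiv.Perm δ := D.rot * D.opp

/-- The diagram is alternating: along every edge one passes from an overcrossing to an undercrossing
or conversely. -/
def Alternating : Prop := ∀ d, D.isOver (D.opp d) = !(D.isOver d)

/-- The diagram is reduced: there is no nugatory crossing, that is, no crossing at which two opposite
corners belong to the same face. -/
def Reduced : Prop := ∀ d, ¬ D.faceNext.SameCycle d (D.rot (D.rot d))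

/-- `(d, t)` with `0 < t < 1` is the point with coordinate `t` on the edge of `d`, measured from the
crossing of `d`. The same point is `(D.opp d, 1 - t)` when seen from the other end. -/
def flip (p : δ × ℝ) : δ × ℝ := (D.opp p.1, 1 - p.2)

/-- Points `(d, t)` are also used for the points of the boundary of the face to the right of `d`.
`D.Btw a p b`: going once around the face of `a` from `a`, in the direction of the dart, one meets
first `p` and then `b`, strictly between `a` and the return to `a`. -/
def Btw (a p b : δ × ℝ) : Prop :=
  ∃ m n : ℕ, p.1 = D.faceNext^[m] a.1 ∧ b.1 = D.faceNext^[n] a.1 ∧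
    a.2 < m + p.2 ∧ m + p.2 < n + b.2 ∧ n + b.2 < a.2 + Function.minimalPeriod D.faceNext a.1

/-- The chords `{a.1, a.2}` and `{b.1, b.2}` of a face cross each other: the end points of one
separate those of the other on the boundary of the face. -/
def ChordsCross (a b : (δ × ℝ) × (δ × ℝ)) : Prop :=
  (D.Btw a.1 b.1 a.2 ∧ D.Btw a.2 b.2 a.1) ∨ (D.Btw a.1 b.2 a.2 ∧ D.Btw a.2 b.1 a.1)

/-- A `PPPP` curve: a simple closed curve on the sphere that meets the diagram transversally in
exactly four points, none of them a crossing. The `k`-th point has coordinate `pos k` on `dart k`,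
and there the curve passes from the right of `dart k` to its left. -/
@[ext] structure PPPPCurve where
  dart : ZMod 4 → δ
  pos : ZMod 4 → ℝ
  pos_mem : ∀ k, pos k ∈ Set.Ioo (0 : ℝ) 1
  /-- the face that the curve enters at the `k`-th point is the face that it leaves at the next
  point -/
  same_face : ∀ k, D.faceNext.SameCycle (D.opp (dart k)) (dart (k + 1))
  /-- the four points are different -/
  points_ne : ∀ j k, j ≠ k →
    (dart j, pos j) ≠ (dart k, pos k) ∧ (dart j, pos j) ≠ D.flip (dart k, pos k)
  /-- the four arcs of the curve inside the faces do not cross each other -/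
  simple : ∀ j k, j ≠ k →
    ¬ D.ChordsCross (D.flip (dart j, pos j), (dart (j + 1), pos (j + 1)))
        (D.flip (dart k, pos k), (dart (k + 1), pos (k + 1)))

namespace PPPPCurve

variable {D} (c b : D.PPPPCurve)

/-- The `k`-th point of the curve on the diagram. -/
def point (k : ZMod 4) : δ × ℝ := (c.dart k, c.pos k)

/-- The arc of the curve from the `k`-th point to the next one, a chord of a face. -/
def chord (k : ZMod 4) : (δ × ℝ) × (δ × ℝ) := (D.flip (c.point k), c.point (k + 1))

/-- The curve passes through the point `p` of the diagram. -/
def Meets (p : δ × ℝ) : Prop := ∃ k, p = c.point k ∨ p = D.flip (c.point k)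

/-- Disjoint curves. -/
def Disjoint : Prop :=
  ∀ j k, c.point j ≠ b.point k ∧ c.point j ≠ D.flip (b.point k) ∧
    ¬ D.ChordsCross (c.chord j) (b.chord k)

/-- `A` is the set of crossings in one of the two disks bounded by the curve:
the two ends of an edge are on different sides exactly if the curve meets the edge an odd number of
times. -/
def BoundsDisk (A : Set D.Crossing) : Prop :=
  ∀ d, Odd {k | c.dart k = d ∨ c.dart k = D.opp d}.ncard ↔
    ¬ (D.crossing d ∈ A ↔ D.crossing (D.opp d) ∈ A)

/-- For the disk bounded by `c` with set of crossings `A`: the points of the edge of `p.1` shortly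
before `p` belong to the disk. If `p` is not on `c`, this says that `p` is in the disk; if `p` is on
`c`, it says that the dart `p.1` leaves the disk at `p`. -/
def InDisk (A : Set D.Crossing) (p : δ × ℝ) : Prop :=
  ¬ (D.crossing p.1 ∈ A ↔
    Odd {k | ∃ u < p.2, (p.1, u) = c.point k ∨ (p.1, u) = D.flip (c.point k)}.ncard)

/-- The disk of `c` with set of crossings `A` lies in the interior of the disk of `b` with set of
crossings `B`. Then the annulus between `c` and `b` contains the crossings of `B \ A`. -/
def Nested (A B : Set D.Crossing) : Prop :=
  c.Disjoint b ∧ (∀ k, b.InDisk B (c.point k)) ∧ ∀ k, ¬ c.InDisk A (b.point k)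

/-- Starting at `p` along the dart `p.1`, and going straight on at a crossing, one reaches the
curve `b` after passing through at most one crossing and without meeting `c` or `b` in between. -/
def RunsTo (p : δ × ℝ) : Prop :=
  (∃ t, p.2 < t ∧ b.Meets (p.1, t) ∧
      ∀ u, p.2 < u → u < t → ¬ c.Meets (p.1, u) ∧ ¬ b.Meets (p.1, u)) ∨
  ((∀ u, p.2 < u → u < 1 → ¬ c.Meets (p.1, u) ∧ ¬ b.Meets (p.1, u)) ∧
    ∃ t, b.Meets (D.rot (D.rot (D.opp p.1)), t) ∧
      ∀ u, 0 < u → u < t → ¬ c.Meets (D.rot (D.rot (D.opp p.1)), u) ∧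
        ¬ b.Meets (D.rot (D.rot (D.opp p.1)), u))

/-- The annulus between the nested curves `c` and `b` contains a single crossing, and it meets the
diagram in four arcs that join distinct boundary components of the annulus. -/
def CrossingAnnulus (A B : Set D.Crossing) : Prop :=
  c.Nested b A B ∧ (∃ v, v ∉ A ∧ B = insert v A) ∧
    ∀ p, c.Meets p → c.InDisk A p → c.RunsTo b p

/-- Alternating diagrams of rational tangles: `c.BoundsRational A` says that the part of the diagram
in the disk of `c` with set of crossings `A` is a two-string tangle without crossings,
surrounded by finitely many annuli, each of which meets the diagram in four arcs joining
distinct boundary components, with a single crossing between two of them. -/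
inductive BoundsRational : D.PPPPCurve → Set D.Crossing → Prop
  | trivial (c : D.PPPPCurve) : c.BoundsDisk ∅ → BoundsRational c ∅
  | surround (c b : D.PPPPCurve) (A B : Set D.Crossing) : BoundsRational c A →
      b.BoundsDisk B → c.CrossingAnnulus b A B → BoundsRational b B

/-- Strong isotopy rel the diagram: a planar isotopy through `PPPP` curves (equivalently, an isotopy
of the four-punctured spheres obtained by capping off the curves on both sides of the
projection sphere). During the isotopy the four points move continuously along the open edges. -/
def StrongIsotopic : Prop :=
  ∃ H : unitInterval → D.PPPPCurve, H 0 = c ∧ H 1 = b ∧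
    (∀ t, (H t).dart = c.dart) ∧ Continuous fun t => (H t).pos

/-- `c` and `b` are the same curve, possibly traversed from another starting point or
backwards. -/
def SameCurve : Prop :=
  ∃ j, (∀ k, b.point k = c.point (j + k)) ∨ (∀ k, b.point k = D.flip (c.point (j - k)))

/-- Parallel curves: they are disjoint, and isotopic rel the diagram. -/
def Parallel : Prop :=
  c.Disjoint b ∧ ∃ b', b.SameCurve b' ∧ c.StrongIsotopic b'

/-- `c` lies completely inside the disk of `b` with set of crossings `B`. -/
def LiesInside (B : Set D.Crossing) : Prop :=
  c.Disjoint b ∧ ∀ k, b.InDisk B (c.point k)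

/-- Flyping curves: there is a `PPPP` curve `b` disjoint from `c` such that the annulus between them
contains a single crossing, and the disk bounded by `b` that is disjoint from `c` contains
at least one crossing (otherwise every curve around a single crossing would be a flyping curve). -/
def IsFlypingCurve : Prop :=
  ∃ (b : D.PPPPCurve) (A B : Set D.Crossing), c.BoundsDisk A ∧ b.BoundsDisk B ∧
    c.Nested b A B ∧ (∃ v, v ∉ A ∧ B = insert v A) ∧ Bᶜ.Nonempty

end PPPPCurve

/-- The structure of a standard diagram of an alternating pseudo-Montesinos link on a diagram `D`:
four rational tangles, each with at least one crossing, in disjoint disks bounded by `Q i`, and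
exactly two crossings outside these disks. The tangles are arranged cyclically (counterclockwise)
around the exterior crossing `north`. The curve `Q i` runs counterclockwise around its tangle
and meets there, in this order, the strand to the exterior crossing `south`, the strand to the next
tangle, the strand to `north`, and the strand to the previous tangle. So cyclically adjacent
tangles are joined by one strand without crossings, opposite tangles are joined by two strands, one
through `north` and one through `south`, and at each of these crossings a strand between the tangles
`0` and `2` crosses a strand between the tangles `1` and `3`. -/
structure StandardPseudoMontesinos where
  Q : ZMod 4 → D.PPPPCurve
  /-- the crossings of the tangle in the disk bounded by `Q i` -/
  T : ZMod 4 → Set D.Crossing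
  north : D.Crossing
  south : D.Crossing
  alternating : D.Alternating
  reduced : D.Reduced
  bounds : ∀ i, (Q i).BoundsDisk (T i)
  outward : ∀ i k, (Q i).InDisk (T i) ((Q i).point k)
  disjoint : ∀ i j, i ≠ j →
    (Q i).Disjoint (Q j) ∧ ∀ k, ¬ (Q i).InDisk (T i) ((Q j).point k)
  rational : ∀ i, (Q i).BoundsRational (T i)
  nonempty : ∀ i, (T i).Nonempty
  /-- the strand between adjacent tangles -/
  next : ∀ i, (Q (i + 1)).dart 3 = D.opp ((Q i).dart 1) ∧
    (Q i).pos 1 < 1 - (Q (i + 1)).pos 3 ∧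
    ∀ u, (Q i).pos 1 < u → u < 1 - (Q (i + 1)).pos 3 → ∀ j, ¬ (Q j).Meets ((Q i).dart 1, u)
  /-- the strand from the tangle to the crossing `north` -/
  to_north : ∀ i, D.crossing (D.opp ((Q i).dart 2)) = north ∧
    ∀ u, (Q i).pos 2 < u → u < 1 → ∀ j, ¬ (Q j).Meets ((Q i).dart 2, u)
  north_rot : ∀ i, D.rot (D.opp ((Q i).dart 2)) = D.opp ((Q (i + 1)).dart 2)
  /-- the strand from the tangle to the crossing `south` -/
  to_south : ∀ i, D.crossing (D.opp ((Q i).dart 0)) = south ∧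
    ∀ u, (Q i).pos 0 < u → u < 1 → ∀ j, ¬ (Q j).Meets ((Q i).dart 0, u)
  south_rot : ∀ i, D.rot (D.opp ((Q (i + 1)).dart 0)) = D.opp ((Q i).dart 0)
  north_ne_south : north ≠ south
  exterior : ∀ v, (∀ i, v ∉ T i) ↔ v = north ∨ v = south

end LinkDiagram

/-! ### Edge cuts of the diagram graph, and nugatory crossings. -/

namespace LinkDiagram

variable {δ : Type*} (D : LinkDiagram δ)

/-! Up to strong isotopy, what matters about a PPPP curve is the set `A` of crossings on one side of
it. Such a set exists because the first homology of the sphere mod 2 vanishes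
(`exists_cut_of_closed`, from the Euler relation). The curve meets every edge that leaves `A`, so at
most four edges leave `A`. If `A` or its complement is empty, alternative 4 holds. The rest is graph
theory of small edge cuts, followed by one geometric move.

A standard diagram is prime: at least four edges leave any nonempty proper set of crossings
(`four_le_cutSize`). Inside a tangle this comes from induction over the annuli of a rational tangle,
where a cut of two edges would make a crossing nugatory or contradict the form of an annulus
(`BoundsRational.two_lt_cutSize`); a cut is even, so more than two means at least four. A set that
splits no tangle is a set of vertices of the octahedron obtained by contracting the four tangles to
points, with the exterior crossings as poles. Nontrivial cuts of the octahedron have at least four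
edges, and those with exactly four isolate a vertex.

Sets that split tangles are reduced to the octahedron by submodularity of the cut size. Hence `A` or
its complement lies in one tangle or is a single exterior crossing (`exists_subset_of_cutSize_le`).

When the set lies in a tangle, the curve meets four different edges once each, so its points can
slide freely along them, close to the crossings of the set; the curve is then inside the tangle disk
(`exists_liesInside`). This includes curves parallel to some `Q i`, which are pushed inside, so
alternative 1 never has to be chosen. Around an exterior crossing, a flype would need a second
crossing `w` such that at most four edges leave the pair, which the classification of cuts excludes
(`not_isFlypingCurve`). -/

theorem rot_ne (d : δ) : D.rot d ≠ d := fun h => D.rot_rot_ne d (by rw [h, h])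

theorem crossing_eq_iff {x y : δ} : D.crossing x = D.crossing y ↔ D.rot.SameCycle x y :=
  Quotient.eq (r := Equiv.Perm.SameCycle.setoid D.rot)

theorem crossing_rot (x : δ) : D.crossing (D.rot x) = D.crossing x := by
  rw [crossing_eq_iff]
  exact Equiv.Perm.sameCycle_apply_left.2 (Equiv.Perm.SameCycle.refl _ _)

theorem crossing_surjective (v : D.Crossing) : ∃ d, D.crossing d = v := Quotient.exists_rep v

theorem faceNext_apply (x : δ) : D.faceNext x = D.rot (D.opp x) := rfl

theorem crossing_faceNext (x : δ) : D.crossing (D.faceNext x) = D.crossing (D.opp x) :=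
  D.crossing_rot _

theorem opp_inj {x y : δ} : D.opp x = D.opp y ↔ x = y := D.opp.injective.eq_iff

theorem eq_opp_iff {x y : δ} : x = D.opp y ↔ y = D.opp x := by
  constructor <;> (rintro rfl; rw [D.opp_opp])

theorem eq_of_crossing_eq {x y : δ} (h : D.crossing x = D.crossing y) :
    y = x ∨ y = D.rot x ∨ y = D.rot (D.rot x) ∨ y = D.rot (D.rot (D.rot x)) := by
  have key : ∀ n : ℕ, (D.rot ^ n) x = x ∨ (D.rot ^ n) x = D.rot x ∨
      (D.rot ^ n) x = D.rot (D.rot x) ∨ (D.rot ^ n) x = D.rot (D.rot (D.rot x)) := by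
    intro n
    induction n with
    | zero => simp
    | succ n ih =>
      rw [pow_succ', Equiv.Perm.mul_apply]
      rcases ih with ih | ih | ih | ih <;> rw [ih] <;> simp [D.rot_four]
  have h4 : D.rot ^ 4 = 1 := by
    ext z
    simp [pow_succ, D.rot_four]
  obtain ⟨i, hi⟩ := D.crossing_eq_iff.1 h
  have : D.rot ^ i = D.rot ^ (i % 4).toNat := by
    have h0 : ((i % 4).toNat : ℤ) = i % 4 := Int.toNat_of_nonneg (by omega)
    rw [← zpow_natCast, h0]
    conv_lhs => rw [← Int.emod_add_mul_ediv i 4, zpow_add, zpow_mul]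
    have : D.rot ^ (4 : ℤ) = 1 := by exact_mod_cast h4
    rw [this]; simp
  rw [← hi, this]
  exact key _

/-- A function of the darts that is invariant under rotation and under passing to the other end of
an edge is constant. -/
theorem eq_of_invariant {α : Type*} (f : δ → α) (h₁ : ∀ x, f (D.rot x) = f x)
    (h₂ : ∀ x, f (D.opp x) = f x) (x y : δ) : f x = f y := by
  obtain ⟨g, hg, rfl⟩ := D.connected x y
  have : ∀ z, f (g z) = f z := by
    induction hg using Subgroup.closure_induction with
    | mem g hg =>
      rcases hg with rfl | rfl
      · exact h₁
      · exact h₂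
    | one => simp
    | mul a b _ _ ha hb => intro z; rw [Equiv.Perm.mul_apply, ha, hb]
    | inv a _ ha => intro z; rw [← ha (a⁻¹ z)]; simp
  exact (this x).symm

/-- The darts that leave a set of crossings. -/
def cutDarts (X : Set D.Crossing) : Set δ := {x | D.crossing x ∈ X ∧ D.crossing (D.opp x) ∉ X}

/-- The number of edges with exactly one end in a set of crossings. -/
noncomputable def cutSize (X : Set D.Crossing) : ℕ := (D.cutDarts X).ncard

variable {D}

theorem mem_cutDarts {X : Set D.Crossing} {x : δ} :
    x ∈ D.cutDarts X ↔ D.crossing x ∈ X ∧ D.crossing (D.opp x) ∉ X := Iff.rfl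

theorem cutDarts_compl (X : Set D.Crossing) : D.cutDarts Xᶜ = D.opp '' D.cutDarts X := by
  ext x
  simp only [mem_cutDarts, Set.mem_compl_iff, not_not, Set.mem_image]
  constructor
  · rintro ⟨h1, h2⟩
    exact ⟨D.opp x, ⟨h2, by rwa [D.opp_opp]⟩, D.opp_opp x⟩
  · rintro ⟨y, ⟨h1, h2⟩, rfl⟩
    exact ⟨h2, by rwa [D.opp_opp]⟩

theorem cutSize_compl (X : Set D.Crossing) : D.cutSize Xᶜ = D.cutSize X := by
  rw [cutSize, cutDarts_compl, Set.ncard_image_of_injective _ D.opp.injective, cutSize]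

theorem even_ncard_of_involution {α : Type*} [Finite α] {s : Set α} (g : α → α)
    (hg : ∀ x ∈ s, g x ∈ s) (hne : ∀ x, g x ≠ x) (hgg : ∀ x, g (g x) = x) : Even s.ncard := by
  classical
  have := Fintype.ofFinite α
  rw [Set.ncard_eq_toFinset_card', ← ZMod.natCast_eq_zero_iff_even, Finset.cast_card]
  refine Finset.sum_involution (fun a _ => g a) (fun _ _ => by decide) (fun a _ _ => hne a)
    (fun a ha => ?_) (fun a _ => hgg a)
  simpa using hg a (by simpa using ha)

/-- Each crossing of `X` carries four darts, and the darts whose edges stay in `X` are paired by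
`opp`; the cut darts are the remainder. -/
theorem even_cutSize [Finite δ] (X : Set D.Crossing) : Even (D.cutSize X) := by
  have h1 : Even {x | D.crossing x ∈ X}.ncard := by
    refine even_ncard_of_involution (fun x => D.rot (D.rot x)) ?_ D.rot_rot_ne D.rot_four
    intro x hx
    simpa [crossing_rot] using hx
  have h2 : Even {x | D.crossing x ∈ X ∧ D.crossing (D.opp x) ∈ X}.ncard :=
    even_ncard_of_involution D.opp (fun x hx => ⟨hx.2, by rw [D.opp_opp]; exact hx.1⟩)
      D.opp_ne D.opp_opp
  have h3 : {x | D.crossing x ∈ X} =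
      {x | D.crossing x ∈ X ∧ D.crossing (D.opp x) ∈ X} ∪ D.cutDarts X := by
    ext x
    simp only [Set.mem_ofPred_eq, Set.mem_union, mem_cutDarts]
    tauto
  rw [h3, Set.ncard_union_eq, Nat.even_add] at h1
  · exact h1.1 h2
  · rw [Set.disjoint_left]
    rintro x ⟨_, h⟩ ⟨_, h'⟩
    exact h' h

theorem eq_univ_or_empty_of_cutDarts_eq_empty {X : Set D.Crossing} (h : D.cutDarts X = ∅) :
    X = ∅ ∨ X = Set.univ := by
  have hx : ∀ x, D.crossing x ∈ X → D.crossing (D.opp x) ∈ X := by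
    intro x hx
    by_contra h'
    exact (h ▸ (⟨hx, h'⟩ : x ∈ D.cutDarts X) : x ∈ (∅ : Set δ))
  have hc := D.eq_of_invariant (fun x => D.crossing x ∈ X) (fun x => by rw [crossing_rot])
    (fun x => propext ⟨fun h => by simpa [D.opp_opp] using hx _ h, hx x⟩)
  rcases X.eq_empty_or_nonempty with h | ⟨v, hv⟩
  · exact Or.inl h
  · right
    obtain ⟨d, rfl⟩ := D.crossing_surjective v
    refine Set.eq_univ_of_forall fun w => ?_
    obtain ⟨e, rfl⟩ := D.crossing_surjective w
    exact (hc d e) ▸ hv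

theorem cutSize_add_le [Finite δ] (X Y : Set D.Crossing) :
    D.cutSize (X ∩ Y) + D.cutSize (X ∪ Y) ≤ D.cutSize X + D.cutSize Y := by
  have e1 := Set.ncard_union_add_ncard_inter (D.cutDarts (X ∩ Y)) (D.cutDarts (X ∪ Y))
  have e2 := Set.ncard_union_add_ncard_inter (D.cutDarts X) (D.cutDarts Y)
  have l1 : (D.cutDarts (X ∩ Y) ∪ D.cutDarts (X ∪ Y)).ncard ≤
      (D.cutDarts X ∪ D.cutDarts Y).ncard := by
    refine Set.ncard_le_ncard ?_
    intro x
    simp only [Set.mem_union, mem_cutDarts, Set.mem_inter_iff]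
    tauto
  have l2 : (D.cutDarts (X ∩ Y) ∩ D.cutDarts (X ∪ Y)).ncard ≤
      (D.cutDarts X ∩ D.cutDarts Y).ncard := by
    refine Set.ncard_le_ncard ?_
    intro x
    simp only [Set.mem_union, mem_cutDarts, Set.mem_inter_iff]
    tauto
  unfold cutSize
  omega

theorem cutSize_diff_add_le [Finite δ] (X Y : Set D.Crossing) :
    D.cutSize (X \ Y) + D.cutSize (Y \ X) ≤ D.cutSize X + D.cutSize Y := by
  have h := cutSize_add_le X Yᶜ
  rw [cutSize_compl Y, ← cutSize_compl (X ∪ Yᶜ), Set.compl_union, compl_compl] at h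
  rwa [Set.inter_comm Xᶜ] at h

/-- An edge of a reduced alternating diagram has different ends. -/
theorem crossing_opp_ne (ha : D.Alternating) (hr : D.Reduced) (d : δ) :
    D.crossing (D.opp d) ≠ D.crossing d := by
  intro h
  -- An edge that returns to the adjacent dart makes `e` and the opposite dart consecutive on a
  -- face.
  have hloop : ∀ e, D.opp e ≠ D.rot e := by
    intro e he
    refine hr e ⟨1, ?_⟩
    rw [zpow_one, faceNext_apply, he]
  rcases D.eq_of_crossing_eq h.symm with h | h | h | h
  · exact D.opp_ne d h
  · exact hloop d h
  -- Opposite darts belong to the same strand, so an edge joining them would not alternate.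
  · have := ha d
    rw [h, D.isOver_rot, D.isOver_rot] at this
    simp at this
  · refine hloop (D.opp d) ?_
    rw [D.opp_opp, h, D.rot_four]

theorem ncard_darts_at (v : D.Crossing) : {x | D.crossing x = v}.ncard = 4 := by
  obtain ⟨d, rfl⟩ := D.crossing_surjective v
  have : {x | D.crossing x = D.crossing d} =
      {d, D.rot d, D.rot (D.rot d), D.rot (D.rot (D.rot d))} := by
    ext x
    simp only [Set.mem_ofPred_eq, Set.mem_insert_iff, Set.mem_singleton_iff]
    constructor
    · exact fun h => D.eq_of_crossing_eq h.symm
    · rintro (rfl | rfl | rfl | rfl) <;> simp [crossing_rot]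
  have n1 := D.rot_ne d
  have n2 := D.rot_rot_ne d
  have n3 : D.rot (D.rot (D.rot d)) ≠ d := fun h => by
    have := D.rot_four d
    rw [h] at this
    exact n1 this
  have i := D.rot.injective
  rw [this, Set.ncard_insert_of_notMem, Set.ncard_insert_of_notMem, Set.ncard_pair]
  · exact fun h => n1 (i (i h)).symm
  · simp only [Set.mem_insert_iff, Set.mem_singleton_iff, not_or]
    exact ⟨fun h => n1 (i h).symm, fun h => n2 (i h).symm⟩
  · simp only [Set.mem_insert_iff, Set.mem_singleton_iff, not_or]
    exact ⟨n1.symm, n2.symm, n3.symm⟩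

theorem cutSize_singleton (ha : D.Alternating) (hr : D.Reduced) (v : D.Crossing) :
    D.cutSize {v} = 4 := by
  rw [cutSize, ← ncard_darts_at v]
  congr 1
  ext x
  simp only [mem_cutDarts, Set.mem_singleton_iff, Set.mem_ofPred_eq, and_iff_left_iff_imp]
  rintro rfl
  exact crossing_opp_ne ha hr x

/-- If the edges that leave a set of crossings are adjacent at a crossing outside the set, this
crossing is nugatory. -/
theorem not_reduced_of_cutDarts_eq [Finite δ] {X : Set D.Crossing} {e : δ}
    (hX : D.cutDarts X = {D.opp e, D.opp (D.rot e)}) : ¬ D.Reduced := by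
  intro hr
  have h1 : D.opp e ∈ D.cutDarts X := by rw [hX]; simp
  have h2 : D.opp (D.rot e) ∈ D.cutDarts X := by rw [hX]; simp
  have heX : D.crossing e ∉ X := by simpa [D.opp_opp] using h1.2
  set f := D.faceNext with hf
  set x := D.rot (D.rot e) with hx
  have hfx : f (D.opp (D.rot e)) = x := by rw [hf, faceNext_apply, D.opp_opp]
  have hsame : f.SameCycle x (D.opp (D.rot e)) := by
    rw [← hfx]
    exact Equiv.Perm.sameCycle_apply_left.2 (Equiv.Perm.SameCycle.refl _ _)
  -- Follow the boundary of the face from `rot (rot e)` up to its first arrival in `X`. It arrives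
  -- along `e` or along `rot e`; the first makes the crossing nugatory.
  have hex : ∃ n : ℕ, D.crossing ((f ^ n) x) ∈ X := by
    obtain ⟨n, _, hn⟩ := hsame.exists_pow_eq'
    exact ⟨n, hn ▸ h2.1⟩
  classical
  have hmin := fun n => Nat.find_min (m := n) hex
  have hs := Nat.find_spec hex
  rcases hn : Nat.find hex with _ | n
  · rw [hn] at hs
    simp only [pow_zero, Equiv.Perm.one_apply, hx, crossing_rot] at hs
    exact heX hs
  rw [hn] at hs hmin
  have hy := hmin n (by omega)
  have hyX : D.opp ((f ^ n) x) ∈ D.cutDarts X := by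
    refine ⟨?_, by rwa [D.opp_opp]⟩
    rwa [pow_succ', Equiv.Perm.mul_apply, hf, crossing_faceNext] at hs
  rw [hX, Set.mem_insert_iff, Set.mem_singleton_iff, opp_inj, opp_inj] at hyX
  rcases hyX with hy' | hy'
  · refine hr e (Equiv.Perm.SameCycle.symm ⟨n, ?_⟩)
    rw [zpow_natCast]
    exact hy'
  -- Arriving along `rot e` would require the previous dart to be `opp e`, which already starts in
  -- `X`.
  · rcases n with _ | n
    · exact D.rot_ne _ hy'
    · have := hmin n (by omega)
      rw [pow_succ', Equiv.Perm.mul_apply, hf, faceNext_apply] at hy'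
      have hy'' := D.rot.injective hy'
      rw [← D.opp_opp ((D.faceNext ^ n) x), hy''] at this
      exact this h1.1

end LinkDiagram

/-! ### Closed curves bound: mod 2 homology of the sphere. -/

namespace LinkDiagram

variable {δ : Type*} (D : LinkDiagram δ)

/-- The edges of the diagram. -/
def Edge : Type _ := Quotient (Equiv.Perm.SameCycle.setoid D.opp)

/-- The faces of the diagram. -/
def Face : Type _ := Quotient (Equiv.Perm.SameCycle.setoid D.faceNext)

/-- The edge of a dart. -/
def edge (d : δ) : D.Edge := Quotient.mk (Equiv.Perm.SameCycle.setoid D.opp) d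

/-- The face to the right of a dart. -/
def face (d : δ) : D.Face := Quotient.mk (Equiv.Perm.SameCycle.setoid D.faceNext) d

instance [Finite δ] : Finite D.Crossing := Quotient.finite _
instance [Finite δ] : Finite D.Edge := Quotient.finite _
instance [Finite δ] : Finite D.Face := Quotient.finite _

variable {D}

theorem face_eq_iff {x y : δ} : D.face x = D.face y ↔ D.faceNext.SameCycle x y :=
  Quotient.eq (r := Equiv.Perm.SameCycle.setoid D.faceNext)

theorem face_faceNext (x : δ) : D.face (D.faceNext x) = D.face x := by
  rw [face_eq_iff]
  exact Equiv.Perm.sameCycle_apply_left.2 (Equiv.Perm.SameCycle.refl _ _)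

theorem face_rot (x : δ) : D.face (D.rot x) = D.face (D.opp x) := by
  rw [← face_faceNext (D.opp x), faceNext_apply, D.opp_opp]

theorem edge_eq_iff {x y : δ} : D.edge x = D.edge y ↔ x = y ∨ x = D.opp y := by
  have h : D.edge x = D.edge y ↔ D.opp.SameCycle x y :=
    Quotient.eq (r := Equiv.Perm.SameCycle.setoid D.opp)
  rw [h]
  constructor
  · rintro ⟨i, hi⟩
    have h2 : D.opp ^ (2 : ℤ) = 1 := by
      ext z
      simp [zpow_ofNat, pow_succ, D.opp_opp]
    rw [← Int.emod_add_mul_ediv i 2, zpow_add, zpow_mul, h2, one_zpow, mul_one] at hi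
    rcases Int.emod_two_eq_zero_or_one i with h | h <;> rw [h] at hi
    · left; simpa using hi
    · right; rw [zpow_one] at hi; rw [← hi, D.opp_opp]
  · rintro (rfl | rfl)
    · exact Equiv.Perm.SameCycle.refl _ _
    · exact Equiv.Perm.sameCycle_apply_left.2 (Equiv.Perm.SameCycle.refl _ _)

open Classical in
/-- A set of edges that meets every face an even number of times consists of the edges with
exactly one end in some set of crossings. -/
theorem exists_cut_of_even [Finite δ] (S : Set δ) (hS : ∀ x, D.opp x ∈ S ↔ x ∈ S)
    (heven : ∀ f : D.Face, Even {x | x ∈ S ∧ D.face x = f}.ncard) :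
    ∃ A : Set D.Crossing, ∀ x, x ∈ S ↔ ¬ (D.crossing x ∈ A ↔ D.crossing (D.opp x) ∈ A) := by
  have := Fintype.ofFinite δ
  have := Fintype.ofFinite D.Crossing
  have := Fintype.ofFinite D.Edge
  have := Fintype.ofFinite D.Face
  -- Without darts the Euler relation would read `0 = 2`.
  have : Nonempty δ := by
    by_contra hne
    rw [not_nonempty_iff] at hne
    have h := D.euler
    rw [Nat.card_eq_zero.2 (Or.inl inferInstance), Nat.card_eq_zero.2 (Or.inl inferInstance),
      Nat.card_eq_zero.2 (Or.inl inferInstance)] at h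
    omega
  obtain ⟨x₀⟩ := this
  have char2 : ∀ a : ZMod 2, a + a = 0 := by decide
  have eq_of_add : ∀ a b : ZMod 2, a + b = 0 → b = a := by decide
  -- the sum over the two darts of an edge
  have sum_edge : ∀ (h : δ → ZMod 2) (x : δ),
      ∑ y with D.edge y = D.edge x, h y = h x + h (D.opp x) := by
    intro h x
    have : (Finset.univ.filter fun y => D.edge y = D.edge x) = {x, D.opp x} := by
      ext y
      simp [edge_eq_iff]
    rw [this, Finset.sum_pair (D.opp_ne x).symm]
  -- `M` and `N` are the mod 2 coboundary maps from crossings to edges and from edges to faces.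
  -- Summing over darts counts an edge twice, hence as zero, at a face that lies on both its sides.
  let N : Matrix D.Face D.Edge (ZMod 2) := Matrix.of fun f e => ∑ x with D.edge x = e,
    if D.face x = f then 1 else 0
  have hN : ∀ (s : D.Edge → ZMod 2) f, N.mulVec s f = ∑ x with D.face x = f, s (D.edge x) := by
    intro s f
    simp only [Matrix.mulVec, dotProduct, N, Matrix.of_apply, Finset.sum_mul, Finset.sum_filter]
    rw [Finset.sum_comm]
    refine Finset.sum_congr rfl fun x _ => ?_
    simp
  have hNt : ∀ (g : D.Face → ZMod 2) x,
      N.transpose.mulVec g (D.edge x) = g (D.face x) + g (D.face (D.opp x)) := by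
    intro g x
    simp only [Matrix.mulVec, dotProduct, N, Matrix.transpose_apply, Matrix.of_apply,
      Finset.sum_mul]
    rw [Finset.sum_comm, ← sum_edge (fun y => g (D.face y))]
    refine Finset.sum_congr rfl fun y _ => ?_
    simp
  let M : Matrix D.Edge D.Crossing (ZMod 2) := Matrix.of fun e v => ∑ x with D.edge x = e,
    if D.crossing x = v then 1 else 0
  have hM : ∀ (h : D.Crossing → ZMod 2) x,
      M.mulVec h (D.edge x) = h (D.crossing x) + h (D.crossing (D.opp x)) := by
    intro g x
    simp only [Matrix.mulVec, dotProduct, M, Matrix.of_apply, Finset.sum_mul]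
    rw [Finset.sum_comm, ← sum_edge (fun y => g (D.crossing y))]
    refine Finset.sum_congr rfl fun y _ => ?_
    simp
  have finrank_const : ∀ {ι : Type _} [Fintype ι] [Nonempty ι],
      Module.finrank (ZMod 2) (Submodule.span (ZMod 2) {(1 : ι → ZMod 2)}) = 1 := by
    intro ι _ _
    exact finrank_span_singleton one_ne_zero
  have : Nonempty D.Crossing := ⟨D.crossing x₀⟩
  have : Nonempty D.Face := ⟨D.face x₀⟩
  have kerM : LinearMap.ker M.mulVecLin = Submodule.span (ZMod 2) {1} := by
    ext h
    rw [LinearMap.mem_ker, Submodule.mem_span_singleton]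
    constructor
    · intro hh
      have hc := D.eq_of_invariant (fun x => h (D.crossing x)) (fun x => by rw [crossing_rot])
        (fun x => eq_of_add _ _ (by rw [← hM]; exact congrFun hh _))
      refine ⟨h (D.crossing x₀), funext fun v => ?_⟩
      obtain ⟨d, rfl⟩ := D.crossing_surjective v
      simpa using hc x₀ d
    · rintro ⟨a, rfl⟩
      funext e
      obtain ⟨x, rfl⟩ : ∃ x, D.edge x = e := Quotient.exists_rep e
      rw [Matrix.mulVecLin_apply, hM]
      simp [char2]
  have kerNt : LinearMap.ker N.transpose.mulVecLin = Submodule.span (ZMod 2) {1} := by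
    ext g
    rw [LinearMap.mem_ker, Submodule.mem_span_singleton]
    constructor
    · intro hh
      have h1 : ∀ x, g (D.face (D.opp x)) = g (D.face x) := fun x =>
        eq_of_add _ _ (by rw [← hNt]; exact congrFun hh _)
      have hc := D.eq_of_invariant (fun x => g (D.face x)) (fun x => by rw [face_rot, h1]) h1
      refine ⟨g (D.face x₀), funext fun v => ?_⟩
      obtain ⟨d, rfl⟩ : ∃ x, D.face x = v := Quotient.exists_rep v
      simpa using hc x₀ d
    · rintro ⟨a, rfl⟩
      funext e
      obtain ⟨x, rfl⟩ : ∃ x, D.edge x = e := Quotient.exists_rep e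
      rw [Matrix.mulVecLin_apply, hNt]
      simp [char2]
  have rM := LinearMap.finrank_range_add_finrank_ker M.mulVecLin
  have rN := LinearMap.finrank_range_add_finrank_ker N.mulVecLin
  have rNt := LinearMap.finrank_range_add_finrank_ker N.transpose.mulVecLin
  have hrank : Module.finrank (ZMod 2) (LinearMap.range N.transpose.mulVecLin) =
      Module.finrank (ZMod 2) (LinearMap.range N.mulVecLin) := N.rank_transpose
  rw [kerM, finrank_const, Module.finrank_fintype_fun_eq_card] at rM
  rw [kerNt, finrank_const, Module.finrank_fintype_fun_eq_card] at rNt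
  rw [Module.finrank_fintype_fun_eq_card] at rN
  have euler : Fintype.card D.Crossing + Fintype.card D.Face = Fintype.card D.Edge + 2 := by
    simp only [← Nat.card_eq_fintype_card]
    exact D.euler
  have hle : LinearMap.range M.mulVecLin ≤ LinearMap.ker N.mulVecLin := by
    rintro _ ⟨h, rfl⟩
    rw [LinearMap.mem_ker]
    funext f
    rw [Matrix.mulVecLin_apply, Matrix.mulVecLin_apply, hN]
    simp only [hM, Finset.sum_add_distrib]
    have : ∑ x with D.face x = f, h (D.crossing (D.opp x)) =
        ∑ x with D.face x = f, h (D.crossing x) := by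
      refine Finset.sum_equiv D.faceNext (fun x => ?_) (fun x _ => ?_)
      · simp [face_faceNext]
      · rw [crossing_faceNext]
    rw [this, char2]
    rfl
  -- With `V`, `E`, `F` the numbers of crossings, edges and faces, connectedness gives `M` rank `V -
  -- 1` and `N` rank `F - 1`. So `ker N` has dimension `E - F + 1 = V - 1`, that of the range of
  -- `M`.
  have heq := Submodule.eq_of_le_of_finrank_eq hle (by omega)
  let s : D.Edge → ZMod 2 := fun e => if ∃ x ∈ S, D.edge x = e then 1 else 0
  have hs : ∀ x, s (D.edge x) = if x ∈ S then 1 else 0 := by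
    intro x
    have : (∃ y ∈ S, D.edge y = D.edge x) ↔ x ∈ S := by
      constructor
      · rintro ⟨y, hy, hyx⟩
        rcases edge_eq_iff.1 hyx with rfl | rfl
        · exact hy
        · exact (hS x).1 hy
      · exact fun h => ⟨x, h, rfl⟩
    simp only [s, this]
  have hsker : s ∈ LinearMap.ker N.mulVecLin := by
    rw [LinearMap.mem_ker]
    funext f
    rw [Matrix.mulVecLin_apply, hN]
    simp only [hs]
    have h := heven f
    rw [Set.ncard_eq_toFinset_card', ← ZMod.natCast_eq_zero_iff_even] at h
    rw [Finset.sum_boole, Finset.filter_filter, Pi.zero_apply, ← h]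
    congr 2
    ext x
    simp [and_comm]
  rw [← heq] at hsker
  obtain ⟨h, hh⟩ := hsker
  refine ⟨{v | h v = 1}, fun x => ?_⟩
  have h1 : h (D.crossing x) + h (D.crossing (D.opp x)) = if x ∈ S then 1 else 0 := by
    rw [← hs, ← hh, Matrix.mulVecLin_apply, hM]
  have : ∀ a b : ZMod 2, a + b = 1 ↔ ¬ (a = 1 ↔ b = 1) := by decide
  simp only [Set.mem_ofPred_eq]
  rw [← this, h1]
  by_cases hx : x ∈ S <;> simp [hx]

open Classical in
/-- A family of darts that are crossed by closed curves (the face to the left of a dart is the face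
to the right of the next one) meets an edge an odd number of times exactly if the ends of the edge
are separated by the family. -/
theorem exists_cut_of_closed [Finite δ] {ι : Type*} [Finite ι] (dart : ι → δ) (σ : Equiv.Perm ι)
    (h : ∀ i, D.face (D.opp (dart i)) = D.face (dart (σ i))) :
    ∃ A : Set D.Crossing, ∀ x, Odd {i | dart i = x ∨ dart i = D.opp x}.ncard ↔
      ¬ (D.crossing x ∈ A ↔ D.crossing (D.opp x) ∈ A) := by
  refine exists_cut_of_even {x | Odd {i | dart i = x ∨ dart i = D.opp x}.ncard}
    (fun x => by simp only [Set.mem_ofPred_eq, D.opp_opp, or_comm]) fun f => ?_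
  have := Fintype.ofFinite δ
  have := Fintype.ofFinite ι
  have hn : ∀ x, (({i | dart i = x ∨ dart i = D.opp x}.ncard : ℕ) : ZMod 2) =
      ∑ i, ((if dart i = x then 1 else 0) + (if D.opp (dart i) = x then 1 else 0)) := by
    intro x
    have : {i | dart i = x ∨ dart i = D.opp x} = {i | dart i = x} ∪ {i | D.opp (dart i) = x} := by
      ext i
      simp only [Set.mem_union, Set.mem_ofPred_eq, eq_comm (a := D.opp (dart i)), D.eq_opp_iff]
    rw [this, Set.ncard_union_eq, Finset.sum_add_distrib, Finset.sum_boole, Finset.sum_boole,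
      Set.ncard_eq_toFinset_card', Set.ncard_eq_toFinset_card']
    · rw [Nat.cast_add]
      congr 3 <;> simp
    · rw [Set.disjoint_left]
      rintro i rfl h'
      exact D.opp_ne _ h'
  have hodd : ∀ n : ℕ, (n : ZMod 2) = if Odd n then 1 else 0 := by
    intro n
    split_ifs with h
    · exact (ZMod.natCast_eq_one_iff_odd).2 h
    · exact (ZMod.natCast_eq_zero_iff_even).2 (Nat.not_odd_iff_even.1 h)
  rw [Set.ncard_eq_toFinset_card', ← ZMod.natCast_eq_zero_iff_even]
  have h1 : (({x | x ∈ {x | Odd {i | dart i = x ∨ dart i = D.opp x}.ncard} ∧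
      D.face x = f}.toFinset.card : ℕ) : ZMod 2) =
      ∑ x with D.face x = f, (({i | dart i = x ∨ dart i = D.opp x}.ncard : ℕ) : ZMod 2) := by
    rw [Finset.sum_congr rfl fun x _ => hodd _, Finset.sum_boole, Finset.filter_filter]
    refine congrArg (Nat.cast (R := ZMod 2)) (congrArg Finset.card ?_)
    ext x
    simp [and_comm]
  rw [h1]
  simp only [hn]
  rw [Finset.sum_comm]
  have h2 : ∀ i, ∑ x with D.face x = f,
      (((if dart i = x then 1 else 0) : ZMod 2) + (if D.opp (dart i) = x then 1 else 0)) =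
      (if D.face (dart i) = f then 1 else 0) + (if D.face (dart (σ i)) = f then 1 else 0) := by
    intro i
    rw [Finset.sum_add_distrib, Finset.sum_ite_eq, Finset.sum_ite_eq, ← h]
    simp
  simp only [h2]
  -- The curves enter each face as often as they leave it, since `σ` is a bijection.
  rw [Finset.sum_add_distrib, Equiv.sum_comp σ (fun i => if D.face (dart i) = f then 1 else 0)]
  exact CharTwo.add_self_eq_zero _

end LinkDiagram

/-! ### Points of a PPPP curve on the edges, and the two sides of the curve. -/

namespace LinkDiagram.PPPPCurve

variable {δ : Type*} {D : LinkDiagram δ} (c b : D.PPPPCurve)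

/-- The points of the curve on the edge of a dart. -/
def hits (d : δ) : Set (ZMod 4) := {k | c.dart k = d ∨ c.dart k = D.opp d}

open Classical in
/-- The coordinate along `d` of a point of the curve on the edge of `d`. -/
noncomputable def coord (d : δ) (k : ZMod 4) : ℝ := if c.dart k = d then c.pos k else 1 - c.pos k

theorem point_or_flip_iff {d : δ} {u : ℝ} {k : ZMod 4} :
    ((d, u) = c.point k ∨ (d, u) = D.flip (c.point k)) ↔ k ∈ c.hits d ∧ c.coord d k = u := by
  simp only [point, flip, Prod.mk.injEq, hits, Set.mem_ofPred_eq, coord]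
  constructor
  · rintro (⟨rfl, rfl⟩ | ⟨rfl, rfl⟩)
    · simp
    · simp [D.opp_opp, (D.opp_ne _).symm]
  · rintro ⟨rfl | h, h2⟩
    · left; simpa using h2.symm
    · right
      refine ⟨by rw [h, D.opp_opp], ?_⟩
      rw [if_neg (by rw [h]; exact D.opp_ne d)] at h2
      exact h2.symm

theorem meets_iff {d : δ} {u : ℝ} : c.Meets (d, u) ↔ ∃ k ∈ c.hits d, c.coord d k = u := by
  simp only [Meets, point_or_flip_iff]

theorem hits_opp (d : δ) : c.hits (D.opp d) = c.hits d := by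
  ext k
  simp only [hits, D.opp_opp, Set.mem_ofPred_eq, or_comm]

variable {c b}

theorem mem_hits_dart (k : ZMod 4) : k ∈ c.hits (c.dart k) := Or.inl rfl

theorem coord_opp {d : δ} {k : ZMod 4} (h : k ∈ c.hits d) :
    c.coord (D.opp d) k = 1 - c.coord d k := by
  rcases h with h | h
  · rw [coord, coord, if_pos h, if_neg (by rw [h]; exact (D.opp_ne d).symm)]
  · rw [coord, coord, if_pos h, if_neg (by rw [h]; exact D.opp_ne d)]; ring

theorem coord_pos (d : δ) (k : ZMod 4) : 0 < c.coord d k := by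
  have := c.pos_mem k
  unfold coord
  split_ifs
  · exact this.1
  · linarith [this.2]

theorem coord_lt_one (d : δ) (k : ZMod 4) : c.coord d k < 1 := by
  have := c.pos_mem k
  unfold coord
  split_ifs
  · exact this.2
  · linarith [this.1]

theorem eq_of_coord_eq {d : δ} {j k : ZMod 4} (hj : j ∈ c.hits d) (hk : k ∈ c.hits d)
    (h : c.coord d j = c.coord d k) : j = k := by
  by_contra hne
  have h1 := c.point_or_flip_iff.2 ⟨hj, rfl⟩
  have h2 := c.point_or_flip_iff.2 ⟨hk, rfl⟩
  rw [← h] at h2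
  have h3 := c.points_ne j k hne
  have ff : ∀ p : δ × ℝ, D.flip (D.flip p) = p := fun p => by simp [flip, D.opp_opp]
  simp only [point] at h1 h2
  rcases h1 with h1 | h1 <;> rcases h2 with h2 | h2
  · exact h3.1 (h1.symm.trans h2)
  · exact h3.2 (h1.symm.trans h2)
  · apply h3.2
    rw [← ff (c.dart j, _), ← h1, h2]
  · apply h3.1
    rw [← ff (c.dart j, _), ← h1, h2, ff]

theorem meets_flip {p : δ × ℝ} : c.Meets (D.flip p) ↔ c.Meets p := by
  have : ∀ p, c.Meets p → c.Meets (D.flip p) := by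
    rintro ⟨d, u⟩ h
    obtain ⟨k, hk, rfl⟩ := c.meets_iff.1 h
    exact c.meets_iff.2 ⟨k, by rwa [hits_opp], coord_opp hk⟩
  refine ⟨fun h => ?_, this p⟩
  have := this _ h
  simpa [flip, D.opp_opp] using this

theorem meets_point (k : ZMod 4) : c.Meets (c.point k) := ⟨k, Or.inl rfl⟩

theorem inDisk_iff {A : Set D.Crossing} {d : δ} {t : ℝ} :
    c.InDisk A (d, t) ↔
      ¬ (D.crossing d ∈ A ↔ Odd {k | k ∈ c.hits d ∧ c.coord d k < t}.ncard) := by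
  unfold InDisk
  have : {k | ∃ u < t, (d, u) = c.point k ∨ (d, u) = D.flip (c.point k)} =
      {k | k ∈ c.hits d ∧ c.coord d k < t} := by
    ext k
    simp only [point_or_flip_iff, Set.mem_ofPred_eq]
    constructor
    · rintro ⟨u, hu, hk, rfl⟩
      exact ⟨hk, hu⟩
    · rintro ⟨hk, hu⟩
      exact ⟨_, hu, hk, rfl⟩
  simp only [this]

theorem inDisk_flip {A : Set D.Crossing} {d : δ} {t : ℝ} : c.InDisk A (D.flip (d, t)) ↔
      ¬ (D.crossing (D.opp d) ∈ A ↔ Odd {k | k ∈ c.hits d ∧ t < c.coord d k}.ncard) := by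
  rw [flip, inDisk_iff]
  have : {k | k ∈ c.hits (D.opp d) ∧ c.coord (D.opp d) k < 1 - t} =
      {k | k ∈ c.hits d ∧ t < c.coord d k} := by
    ext k
    simp only [hits_opp, Set.mem_ofPred_eq]
    refine and_congr_right fun hk => ?_
    rw [coord_opp hk]
    constructor <;> intro <;> linarith
  simp only [this]

/-- The points of the curve before `p` and those after `p` together are all its points on the edge,
and their parity is prescribed by the ends of the edge. -/
theorem inDisk_flip_of_not_meets {A : Set D.Crossing} (hA : c.BoundsDisk A) {p : δ × ℝ}
    (h : ¬ c.Meets p) : c.InDisk A (D.flip p) ↔ c.InDisk A p := by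
  obtain ⟨d, t⟩ := p
  rw [inDisk_flip, inDisk_iff]
  have h1 := hA d
  have h2 : {k | c.dart k = d ∨ c.dart k = D.opp d} =
      {k | k ∈ c.hits d ∧ c.coord d k < t} ∪ {k | k ∈ c.hits d ∧ t < c.coord d k} := by
    ext k
    simp only [Set.mem_union, Set.mem_ofPred_eq, ← and_or_left]
    refine ⟨fun hk => ⟨hk, ?_⟩, fun hk => hk.1⟩
    exact lt_or_gt_of_ne fun he => h (c.meets_iff.2 ⟨k, hk, he⟩)
  rw [h2, Set.ncard_union_eq, Nat.odd_add, ← Nat.not_odd_iff_even] at h1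
  · tauto
  · rw [Set.disjoint_left]
    rintro k ⟨_, h⟩ ⟨_, h'⟩
    exact lt_asymm h h'

/-- As for a point off the curve, except that `p` itself adds one to the count. So exactly one of
the two darts at `p` leaves the disk. -/
theorem inDisk_flip_of_meets {A : Set D.Crossing} (hA : c.BoundsDisk A) {p : δ × ℝ}
    (h : c.Meets p) : c.InDisk A (D.flip p) ↔ ¬ c.InDisk A p := by
  obtain ⟨d, t⟩ := p
  rw [inDisk_flip, inDisk_iff]
  have h1 := hA d
  obtain ⟨j, hj, hjt⟩ := c.meets_iff.1 h
  have h2 : {k | c.dart k = d ∨ c.dart k = D.opp d} =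
      insert j ({k | k ∈ c.hits d ∧ c.coord d k < t} ∪ {k | k ∈ c.hits d ∧ t < c.coord d k}) := by
    ext k
    simp only [Set.mem_insert_iff, Set.mem_union, Set.mem_ofPred_eq, ← and_or_left]
    constructor
    · intro hk
      rcases lt_trichotomy (c.coord d k) t with h | h | h
      · exact Or.inr ⟨hk, Or.inl h⟩
      · exact Or.inl (eq_of_coord_eq hk hj (h.trans hjt.symm))
      · exact Or.inr ⟨hk, Or.inr h⟩
    · rintro (rfl | hk)
      · exact hj
      · exact hk.1
  rw [h2, Set.ncard_insert_of_notMem, Set.ncard_union_eq, Nat.odd_add_one, Nat.odd_add,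
    ← Nat.not_odd_iff_even] at h1
  · tauto
  · rw [Set.disjoint_left]
    rintro k ⟨_, h⟩ ⟨_, h'⟩
    exact lt_asymm h h'
  · simp only [Set.mem_union, Set.mem_ofPred_eq, hjt, lt_irrefl, and_false, or_self,
      not_false_eq_true]

theorem inDisk_congr {A : Set D.Crossing} {d : δ} {t t' : ℝ} (ht : t ≤ t')
    (h : ∀ u, t ≤ u → u < t' → ¬ c.Meets (d, u)) : c.InDisk A (d, t) ↔ c.InDisk A (d, t') := by
  rw [inDisk_iff, inDisk_iff]
  have : {k | k ∈ c.hits d ∧ c.coord d k < t} = {k | k ∈ c.hits d ∧ c.coord d k < t'} := by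
    ext k
    refine and_congr_right fun hk => ⟨fun h => h.trans_le ht, fun h' => ?_⟩
    by_contra h''
    exact h _ (not_lt.1 h'') h' (c.meets_iff.2 ⟨k, hk, rfl⟩)
  simp only [this]

theorem inDisk_iff_crossing_mem {A : Set D.Crossing} {d : δ} {t : ℝ}
    (h : ∀ u < t, ¬ c.Meets (d, u)) : c.InDisk A (d, t) ↔ D.crossing d ∈ A := by
  rw [inDisk_iff]
  have : {k | k ∈ c.hits d ∧ c.coord d k < t} = ∅ := by
    refine Set.eq_empty_of_forall_notMem fun k hk => ?_
    exact h _ hk.2 (c.meets_iff.2 ⟨k, hk.1, rfl⟩)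
  simp [this]

theorem inDisk_iff_crossing_opp_mem {A : Set D.Crossing} (hA : c.BoundsDisk A) {d : δ} {t : ℝ}
    (h : ∀ u, t ≤ u → ¬ c.Meets (d, u)) : c.InDisk A (d, t) ↔ D.crossing (D.opp d) ∈ A := by
  rw [← inDisk_flip_of_not_meets hA (h t le_rfl), flip]
  refine inDisk_iff_crossing_mem fun u hu hm => h (1 - u) (by linarith) ?_
  have := meets_flip.2 hm
  simpa [flip, D.opp_opp] using this

theorem BoundsDisk.compl {A : Set D.Crossing} (hA : c.BoundsDisk A) : c.BoundsDisk Aᶜ := by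
  intro d
  rw [hA d]
  simp only [Set.mem_compl_iff]
  tauto

theorem BoundsDisk.nonempty_hits {A : Set D.Crossing} (hA : c.BoundsDisk A) {d : δ}
    (h : ¬ (D.crossing d ∈ A ↔ D.crossing (D.opp d) ∈ A)) : (c.hits d).Nonempty := by
  have := (hA d).2 h
  exact Set.nonempty_of_ncard_ne_zero fun h0 => by
    unfold hits at h0
    rw [h0] at this
    simp at this

/-- An edge with ends on different sides is met an odd number of times, so a point can be chosen on
each. -/
theorem BoundsDisk.exists_injective {A : Set D.Crossing} (hA : c.BoundsDisk A) :
    ∃ f : D.cutDarts A → ZMod 4, Function.Injective f ∧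
      ∀ x : D.cutDarts A, f x ∈ c.hits (x : δ) := by
  have h : ∀ x : D.cutDarts A, (c.hits x).Nonempty := fun x =>
    hA.nonempty_hits fun h => x.2.2 (h.1 x.2.1)
  choose f hf using h
  refine ⟨f, fun x y hxy => ?_, hf⟩
  have hx := hf x
  have hy := hf y
  rw [← hxy] at hy
  have key : (x : δ) = y ∨ (x : δ) = D.opp y := by
    rcases hx with hx | hx <;> rcases hy with hy | hy
    · exact Or.inl (hx.symm.trans hy)
    · exact Or.inr (hx.symm.trans hy)
    · right; rw [← hy, hx, D.opp_opp]
    · left; rw [hx] at hy; exact D.opp.injective hy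
  rcases key with h | h
  · exact Subtype.ext h
  · exact (y.2.2 (h ▸ x.2.1)).elim

theorem BoundsDisk.cutSize_le {A : Set D.Crossing} (hA : c.BoundsDisk A) : D.cutSize A ≤ 4 := by
  obtain ⟨f, hf, _⟩ := hA.exists_injective
  have := Nat.card_le_card_of_injective f hf
  rwa [Nat.card_zmod] at this

variable (c) in
/-- The curve meets every edge at most once. -/
def EdgeInjective : Prop := ∀ d j k, j ∈ c.hits d → k ∈ c.hits d → j = k

variable (c) in
/-- Every edge that the curve meets has exactly one end in `A`. -/
def Tight (A : Set D.Crossing) : Prop :=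
  ∀ d, (c.hits d).Nonempty → ¬ (D.crossing d ∈ A ↔ D.crossing (D.opp d) ∈ A)

/-- When four edges leave `A`, the choice of a point on each of them uses up all four points of the
curve. -/
theorem BoundsDisk.edgeInjective_and_tight {A : Set D.Crossing} (hA : c.BoundsDisk A)
    (h4 : 4 ≤ D.cutSize A) : c.EdgeInjective ∧ c.Tight A := by
  obtain ⟨f, hf, hfx⟩ := hA.exists_injective
  have hfin : Finite (D.cutDarts A) := Finite.of_injective f hf
  have hsurj : Function.Surjective f := by
    have : Function.Bijective f := by
      rw [Nat.bijective_iff_injective_and_card]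
      refine ⟨hf, le_antisymm (Nat.card_le_card_of_injective f hf) ?_⟩
      rw [Nat.card_zmod]
      exact h4
    exact this.2
  have key : ∀ d k, k ∈ c.hits d → ∃ x : D.cutDarts A, f x = k ∧
      ((x : δ) = d ∨ (x : δ) = D.opp d) := by
    intro d k hk
    obtain ⟨x, rfl⟩ := hsurj k
    refine ⟨x, rfl, ?_⟩
    rcases hfx x with hx | hx <;> rcases hk with hk | hk
    · exact Or.inl (hx.symm.trans hk)
    · exact Or.inr (hx.symm.trans hk)
    · right; rw [← hk, hx, D.opp_opp]
    · left; rw [hx] at hk; exact D.opp.injective hk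
  constructor
  · intro d j k hj hk
    obtain ⟨x, rfl, hx⟩ := key d j hj
    obtain ⟨y, rfl, hy⟩ := key d k hk
    congr 1
    apply Subtype.ext
    rcases hx with hx | hx <;> rcases hy with hy | hy
    · rw [hx, hy]
    · exact (x.2.2 (by rw [hx, ← hy]; exact y.2.1)).elim
    · exact (y.2.2 (by rw [hy, ← hx]; exact x.2.1)).elim
    · rw [hx, hy]
  · rintro d ⟨k, hk⟩
    obtain ⟨x, rfl, hx | hx⟩ := key d k hk
    · rw [← hx]
      exact fun h => x.2.2 (h.1 x.2.1)
    · have h1 := x.2.1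
      have h2 := x.2.2
      rw [hx] at h1 h2
      rw [D.opp_opp] at h2
      exact fun h => h2 (h.2 h1)

/-- Whether `A` and `B` agree at a crossing does not change along an edge, and the diagram is
connected. -/
theorem BoundsDisk.eq_or_eq_compl {A B : Set D.Crossing} (hA : c.BoundsDisk A)
    (hB : c.BoundsDisk B) : A = B ∨ A = Bᶜ := by
  have h : ∀ d, (D.crossing d ∈ A ↔ D.crossing d ∈ B) =
      (D.crossing (D.opp d) ∈ A ↔ D.crossing (D.opp d) ∈ B) := by
    intro d
    have := (hA d).symm.trans (hB d)
    apply propext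
    tauto
  have hc := D.eq_of_invariant (fun d => (D.crossing d ∈ A ↔ D.crossing d ∈ B))
    (fun x => by rw [crossing_rot]) (fun x => (h x).symm)
  by_cases h0 : ∃ d, (D.crossing d ∈ A ↔ D.crossing d ∈ B)
  · obtain ⟨d, hd⟩ := h0
    left
    ext v
    obtain ⟨e, rfl⟩ := D.crossing_surjective v
    exact (hc d e) ▸ hd
  · right
    ext v
    obtain ⟨e, rfl⟩ := D.crossing_surjective v
    have : ¬ _ := fun he => h0 ⟨e, he⟩
    rw [Set.mem_compl_iff]
    tauto

variable (c) in
/-- Every closed curve bounds a disk. -/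
theorem exists_boundsDisk [Finite δ] : ∃ A, c.BoundsDisk A :=
  exists_cut_of_closed c.dart (Equiv.addRight 1) fun i => face_eq_iff.2 (c.same_face i)

end LinkDiagram.PPPPCurve

/-! ### Crossing annuli and rational tangles. -/

namespace LinkDiagram.PPPPCurve

variable {δ : Type*} {D : LinkDiagram δ} {c b : D.PPPPCurve} {A B : Set D.Crossing}

theorem Meets.pos {d : δ} {u : ℝ} (h : c.Meets (d, u)) : 0 < u := by
  obtain ⟨k, _, rfl⟩ := c.meets_iff.1 h
  exact coord_pos d k

theorem Meets.lt_one {d : δ} {u : ℝ} (h : c.Meets (d, u)) : u < 1 := by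
  obtain ⟨k, _, rfl⟩ := c.meets_iff.1 h
  exact coord_lt_one d k

theorem flip_flip (p : δ × ℝ) : D.flip (D.flip p) = p := by simp [flip, D.opp_opp]

theorem Disjoint.not_meets (h : c.Disjoint b) {p : δ × ℝ} (hp : c.Meets p) : ¬ b.Meets p := by
  obtain ⟨j, hj⟩ := hp
  rintro ⟨k, hk⟩
  obtain ⟨h1, h2, _⟩ := h j k
  rcases hj with hj | hj <;> rcases hk with hk | hk
  · exact h1 (hj.symm.trans hk)
  · exact h2 (hj.symm.trans hk)
  · apply h2
    rw [← hk, hj, flip_flip]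
  · apply h1
    rw [← flip_flip (b.point k), ← hk, hj, flip_flip]

variable (c) in
/-- No point of the curve precedes, on the same edge, a point at which the edge leaves the disk. -/
def Clear (A : Set D.Crossing) : Prop :=
  ∀ d t u, c.Meets (d, t) → c.InDisk A (d, t) → u < t → ¬ c.Meets (d, u)

theorem EdgeInjective.eq_of_meets (h : c.EdgeInjective) {d : δ} {t u : ℝ} (ht : c.Meets (d, t))
    (hu : c.Meets (d, u)) : t = u := by
  obtain ⟨j, hj, rfl⟩ := c.meets_iff.1 ht
  obtain ⟨k, hk, rfl⟩ := c.meets_iff.1 hu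
  rw [h d j k hj hk]

theorem EdgeInjective.clear (h : c.EdgeInjective) : c.Clear A :=
  fun _ _ _ ht _ hlt hu => hlt.ne (h.eq_of_meets hu ht)

theorem Clear.crossing_mem (h : c.Clear A) {d : δ} {t : ℝ} (hm : c.Meets (d, t))
    (hi : c.InDisk A (d, t)) : D.crossing d ∈ A :=
  (inDisk_iff_crossing_mem fun u hu => h d t u hm hi hu).1 hi

/-- Each point of the curve on the diagram can be viewed so that its dart leaves the disk. -/
theorem BoundsDisk.exists_outward (hA : c.BoundsDisk A) (k : ZMod 4) :
    ∃ p, (p = c.point k ∨ p = D.flip (c.point k)) ∧ c.InDisk A p := by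
  by_cases h : c.InDisk A (c.point k)
  · exact ⟨_, Or.inl rfl, h⟩
  · exact ⟨_, Or.inr rfl, (inDisk_flip_of_meets hA (meets_point k)).2 h⟩

theorem BoundsDisk.outward_unique (hA : c.BoundsDisk A) {k : ZMod 4} {p q : δ × ℝ}
    (hp : p = c.point k ∨ p = D.flip (c.point k)) (hpi : c.InDisk A p)
    (hq : q = c.point k ∨ q = D.flip (c.point k)) (hqi : c.InDisk A q) : p = q := by
  have := inDisk_flip_of_meets hA (meets_point k)
  rcases hp with rfl | rfl <;> rcases hq with rfl | rfl <;> first | rfl | tauto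

theorem index_unique {j k : ZMod 4} {p : δ × ℝ} (hj : p = c.point j ∨ p = D.flip (c.point j))
    (hk : p = c.point k ∨ p = D.flip (c.point k)) : j = k := by
  obtain ⟨d, u⟩ := p
  obtain ⟨h1, h2⟩ := c.point_or_flip_iff.1 hj
  obtain ⟨h3, h4⟩ := c.point_or_flip_iff.1 hk
  exact eq_of_coord_eq h1 h3 (h2.trans h4.symm)

theorem BoundsRational.boundsDisk (h : c.BoundsRational A) : c.BoundsDisk A := by
  cases h <;> assumption

theorem Nested.inDisk (hB : b.BoundsDisk B) (h : c.Nested b A B) {p : δ × ℝ} (hp : c.Meets p) :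
    b.InDisk B p := by
  obtain ⟨k, rfl | rfl⟩ := id hp
  · exact h.2.1 k
  · rw [inDisk_flip_of_not_meets hB (h.1.not_meets (meets_point k))]
    exact h.2.1 k

theorem Nested.not_inDisk (hA : c.BoundsDisk A) (h : c.Nested b A B) {q : δ × ℝ}
    (hq : b.Meets q) : ¬ c.InDisk A q := by
  obtain ⟨k, rfl | rfl⟩ := id hq
  · exact h.2.2 k
  · rw [inDisk_flip_of_not_meets hA fun hc => h.1.not_meets hc (meets_point k)]
    exact h.2.2 k

variable (c b) in
/-- Going straight on from `p`, through at most one crossing, `q` is reached before any other point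
of the curves `c` and `b`. -/
def StraightRun (p q : δ × ℝ) : Prop :=
  (q.1 = p.1 ∧ p.2 < q.2 ∧
    ∀ u, p.2 < u → u < q.2 → ¬ c.Meets (p.1, u) ∧ ¬ b.Meets (p.1, u)) ∨
  (q.1 = D.rot (D.rot (D.opp p.1)) ∧
    (∀ u, p.2 < u → u < 1 → ¬ c.Meets (p.1, u) ∧ ¬ b.Meets (p.1, u)) ∧
    ∀ u, 0 < u → u < q.2 → ¬ c.Meets (q.1, u) ∧ ¬ b.Meets (q.1, u))

theorem RunsTo.exists_straightRun {p : δ × ℝ} (h : c.RunsTo b p) :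
    ∃ q, b.Meets q ∧ c.StraightRun b p q := by
  rcases h with ⟨t, h1, h2, h3⟩ | ⟨h1, t, h2, h3⟩
  · exact ⟨_, h2, Or.inl ⟨rfl, h1, h3⟩⟩
  · exact ⟨_, h2, Or.inr ⟨rfl, h1, h3⟩⟩

theorem StraightRun.inDisk (hB : b.BoundsDisk B) (h : c.Nested b A B) {p q : δ × ℝ}
    (hp : c.Meets p) (hr : c.StraightRun b p q) : b.InDisk B q := by
  obtain ⟨d, t⟩ := p
  obtain ⟨e, s⟩ := q
  have hpb := h.1.not_meets hp
  have hpB := h.inDisk hB hp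
  rcases hr with ⟨rfl, h2, h3⟩ | ⟨rfl, h2, h3⟩
  · refine (inDisk_congr h2.le fun u hu hu' => ?_).1 hpB
    rcases hu.eq_or_lt with rfl | hu
    · exact hpb
    · exact (h3 u hu hu').2
  · refine (inDisk_iff_crossing_mem fun u hu hm => (h3 u hm.pos hu).2 hm).2 ?_
    rw [crossing_rot, crossing_rot]
    refine (inDisk_iff_crossing_opp_mem hB fun u hu hm => ?_).1 hpB
    rcases hu.eq_or_lt with rfl | hu
    · exact hpb hm
    · exact (h2 u hu hm.lt_one).2 hm

/-- Traced back from `q`, both runs follow the same strand; the nearer of two starting points would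
interrupt the other run. -/
theorem StraightRun.injective {p p' q : δ × ℝ} (hp : c.Meets p) (hp' : c.Meets p')
    (h : c.StraightRun b p q) (h' : c.StraightRun b p' q) : p = p' := by
  obtain ⟨d, t⟩ := p
  obtain ⟨d', t'⟩ := p'
  obtain ⟨e, s⟩ := q
  rcases h with ⟨h1, h2, h3⟩ | ⟨h1, h2, h3⟩ <;> rcases h' with ⟨h1', h2', h3'⟩ | ⟨h1', h2', h3'⟩
  · obtain rfl : d = d' := h1.symm.trans h1'
    rcases lt_trichotomy t t' with hlt | rfl | hlt
    · exact ((h3 _ hlt h2').1 hp').elim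
    · rfl
    · exact ((h3' _ hlt h2).1 hp).elim
  · obtain rfl : e = d := h1
    exact ((h3' _ hp.pos h2).1 hp).elim
  · obtain rfl : e = d' := h1'
    exact ((h3 _ hp'.pos h2').1 hp').elim
  · obtain rfl : d = d' := D.opp.injective (D.rot.injective (D.rot.injective (h1.symm.trans h1')))
    rcases lt_trichotomy t t' with hlt | rfl | hlt
    · exact ((h2 _ hlt hp'.lt_one).1 hp').elim
    · rfl
    · exact ((h2' _ hlt hp.lt_one).1 hp).elim

theorem CrossingAnnulus.subset (h : c.CrossingAnnulus b A B) : A ⊆ B := by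
  obtain ⟨_, ⟨v, _, rfl⟩, _⟩ := h
  exact Set.subset_insert v A

/-- Every point of the outer curve of a crossing annulus is reached from the inner curve. -/
theorem CrossingAnnulus.exists_straightRun (hA : c.BoundsDisk A) (hB : b.BoundsDisk B)
    (h : c.CrossingAnnulus b A B) {q : δ × ℝ} (hq : b.Meets q) (hqi : b.InDisk B q) :
    ∃ p, c.Meets p ∧ c.InDisk A p ∧ c.StraightRun b p q := by
  obtain ⟨hn, _, hrun⟩ := h
  choose p hp hpi using hA.exists_outward
  have hpm : ∀ k, c.Meets (p k) := fun k => ⟨k, hp k⟩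
  choose r hr hpr using fun k => (hrun _ (hpm k) (hpi k)).exists_straightRun
  have hri := fun k => (hpr k).inDisk hB hn (hpm k)
  choose l hl using hr
  -- The runs from the four inner points end at different outer points, so they reach all four.
  have hinj : Function.Injective l := by
    intro j k hjk
    have hlk := hl k
    rw [← hjk] at hlk
    have h1 := hB.outward_unique (hl j) (hri j) hlk (hri k)
    have h2 := (h1 ▸ hpr j).injective (hpm j) (hpm k) (hpr k)
    exact index_unique (hp j) (h2 ▸ hp k)
  obtain ⟨m, hm⟩ := hq
  obtain ⟨k, rfl⟩ := Finite.surjective_of_injective hinj m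
  exact ⟨p k, hpm k, hpi k, hB.outward_unique (hl k) (hri k) hm hqi ▸ hpr k⟩

theorem CrossingAnnulus.clear (hA : c.BoundsDisk A) (hB : b.BoundsDisk B)
    (h : c.CrossingAnnulus b A B) (hc : c.Clear A) : b.Clear B := by
  intro d t u hm hi hu hmu
  obtain ⟨⟨e, s⟩, hpm, hpi, hr⟩ := h.exists_straightRun hA hB hm hi
  rcases hr with ⟨h1, h2, h3⟩ | ⟨h1, h2, h3⟩
  · obtain rfl : d = e := h1
    rcases lt_trichotomy s u with hlt | rfl | hlt
    · exact (h3 u hlt hu).2 hmu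
    · exact h.1.1.not_meets hpm hmu
    -- No point of `c` precedes `p`, so a point of `b` before `p` would lie in the inner disk.
    · refine h.1.not_inDisk hA hmu ((inDisk_iff_crossing_mem fun w hw => ?_).2
        (hc.crossing_mem hpm hpi))
      exact hc _ _ _ hpm hpi (hw.trans hlt)
  · exact (h3 u hmu.pos hu).2 hmu

/-- The induction starts at the annulus with the first crossing: four edges leave a single crossing,
so the curve around it meets each of them once. For the tangle without crossings the claim fails,
since an edge that leaves its disk must have entered it earlier. -/
theorem BoundsRational.clear (ha : D.Alternating) (hr : D.Reduced) (h : c.BoundsRational A)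
    (hA : A.Nonempty) : c.Clear A := by
  induction h with
  | trivial c _ => exact (Set.not_nonempty_empty hA).elim
  | surround c b A B hc hb hann ih =>
    rcases A.eq_empty_or_nonempty with rfl | hne
    · obtain ⟨_, ⟨v, _, rfl⟩, _⟩ := hann
      refine (hb.edgeInjective_and_tight (le_of_eq ?_)).1.clear
      rw [insert_empty_eq, cutSize_singleton ha hr]
    · exact hann.clear hc.boundsDisk hb (ih hne)

/-- If every edge that leaves the disk of the curve ends outside the disk, the curve meets four
different edges. -/
theorem Clear.four_le_cutSize [Finite δ] (hA : c.BoundsDisk A) (hc : c.Clear A)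
    (h : ∀ p, c.Meets p → c.InDisk A p → D.crossing (D.opp p.1) ∉ A) : 4 ≤ D.cutSize A := by
  choose p hp hpi using hA.exists_outward
  have hpm : ∀ k, c.Meets (p k) := fun k => ⟨k, hp k⟩
  have hmem : ∀ k, (p k).1 ∈ D.cutDarts A := fun k =>
    ⟨hc.crossing_mem (hpm k) (hpi k), h _ (hpm k) (hpi k)⟩
  have hinj : Function.Injective fun k => (⟨(p k).1, hmem k⟩ : D.cutDarts A) := by
    intro j k hjk
    have h1 : (p j).1 = (p k).1 := congrArg Subtype.val hjk
    have h2 : (p j).2 = (p k).2 := by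
      rcases lt_trichotomy (p j).2 (p k).2 with hlt | heq | hlt
      · refine (hc _ _ _ (hpm k) (hpi k) hlt ?_).elim
        rw [← h1]
        exact hpm j
      · exact heq
      · refine (hc _ _ _ (hpm j) (hpi j) hlt ?_).elim
        rw [h1]
        exact hpm k
    exact index_unique (hp j) ((Prod.ext h1 h2 : p j = p k) ▸ hp k)
  have := Nat.card_le_card_of_injective _ hinj
  rwa [Nat.card_zmod] at this

/-- If the outer curve of a crossing annulus meets four different edges, so does the inner
one. -/
theorem CrossingAnnulus.four_le_cutSize [Finite δ] (hA : c.BoundsDisk A)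
    (h : c.CrossingAnnulus b A B) (hc : c.Clear A) (hb : b.Tight B) : 4 ≤ D.cutSize A := by
  obtain ⟨hn, _, hrun⟩ := id h
  refine hc.four_le_cutSize hA fun p hpm hpi hk' => ?_
  have hk := hc.crossing_mem hpm hpi
  obtain ⟨k, hp⟩ := id hpm
  -- If `p.1` ended in `A`, a run along this edge would put a point of `b` on an edge with both ends
  -- in `B`; a run reaching the end of the edge would make `c` meet the edge just once, which
  -- separates its ends.
  rcases hrun _ hpm hpi with ⟨t, _, ht, _⟩ | ⟨h1, _⟩
  · obtain ⟨l, hl, _⟩ := b.meets_iff.1 ht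
    exact hb _ ⟨l, hl⟩ ⟨fun _ => h.subset hk', fun _ => h.subset hk⟩
  · have hodd := (not_congr (hA p.1)).2 (not_not.2 ⟨fun _ => hk', fun _ => hk⟩)
    refine hodd ?_
    have : {j | c.dart j = p.1 ∨ c.dart j = D.opp p.1} = {k} := by
      ext j
      obtain ⟨hk1, hk2⟩ := c.point_or_flip_iff.1 hp
      refine ⟨fun hj => ?_, ?_⟩
      · have hjm : c.Meets (p.1, c.coord p.1 j) := c.meets_iff.2 ⟨j, hj, rfl⟩
        rcases lt_trichotomy (c.coord p.1 j) p.2 with hlt | heq | hlt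
        · exact (hc _ _ _ hpm hpi hlt hjm).elim
        · exact eq_of_coord_eq hj hk1 (heq.trans hk2.symm)
        · exact ((h1 _ hlt hjm.lt_one).1 hjm).elim
      · rintro rfl
        exact hk1
    rw [this, Set.ncard_singleton]
    exact odd_one

/-- Let `k`, `r`, `l` be the numbers of edges from `v` to `A`, from `A` to the rest, and from `v` to
the rest. Then `k + r ≥ 4`, `r + l ≤ 4` and `k + l ≥ 4`, whence `k ≥ 2`. -/
theorem exists_two_edges_of_insert [Finite δ] (ha : D.Alternating) (hr : D.Reduced)
    {v : D.Crossing} (hv : v ∉ A) (h1 : 4 ≤ D.cutSize A) (h2 : D.cutSize (insert v A) ≤ 4) :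
    ∃ e e', e ≠ e' ∧ (D.crossing e = v ∧ D.crossing (D.opp e) ∈ A) ∧
      D.crossing e' = v ∧ D.crossing (D.opp e') ∈ A := by
  let K : Set δ := {x | D.crossing x = v ∧ D.crossing (D.opp x) ∈ A}
  let R : Set δ := {x | D.crossing x ∈ A ∧ D.crossing (D.opp x) ∉ insert v A}
  let L : Set δ := {x | D.crossing x = v ∧ D.crossing (D.opp x) ∉ insert v A}
  have e1 : D.cutDarts A ⊆ D.opp '' K ∪ R := by
    rintro x ⟨hx, hx'⟩
    by_cases h : D.crossing (D.opp x) = v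
    · exact Or.inl ⟨D.opp x, ⟨h, by rwa [D.opp_opp]⟩, D.opp_opp x⟩
    · exact Or.inr ⟨hx, fun h' => h'.elim h hx'⟩
  have e2 : R ∪ L ⊆ D.cutDarts (insert v A) := by
    rintro x (⟨hx, hx'⟩ | ⟨hx, hx'⟩)
    · exact ⟨Or.inr hx, hx'⟩
    · exact ⟨Or.inl hx, hx'⟩
  have e3 : {x | D.crossing x = v} ⊆ K ∪ L := by
    intro x hx
    by_cases h : D.crossing (D.opp x) ∈ A
    · exact Or.inl ⟨hx, h⟩
    · refine Or.inr ⟨hx, fun h' => h'.elim (fun h'' => ?_) h⟩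
      exact crossing_opp_ne ha hr x (h''.trans hx.symm)
  have e4 : _root_.Disjoint R L := by
    rw [Set.disjoint_left]
    rintro x ⟨hx, _⟩ ⟨hx', _⟩
    exact hv (hx' ▸ hx)
  have n1 := (Set.ncard_le_ncard e1).trans (Set.ncard_union_le _ _)
  rw [Set.ncard_image_of_injective _ D.opp.injective] at n1
  have n2 := Set.ncard_le_ncard e2
  rw [Set.ncard_union_eq e4] at n2
  have n3 := (Set.ncard_le_ncard e3).trans (Set.ncard_union_le _ _)
  rw [ncard_darts_at] at n3
  unfold cutSize at h1 h2
  obtain ⟨e, e', he, he', hne⟩ := (Set.one_lt_ncard_iff (s := K)).1 (by omega)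
  exact ⟨e, e', hne, he, he'⟩

/-- Two edges join `v` to `A`, and both leave `X`; if the cut had at most two edges, these would be
all. If they are adjacent at `v`, then `v` is nugatory. If they are opposite, the strand leaving `A`
towards `v` goes straight back to `A`, so its arc in the annulus would meet `b` on an edge with both
ends in `insert v A`, although `b` is tight. -/
theorem CrossingAnnulus.two_lt_cutSize_of_subset [Finite δ] (ha : D.Alternating) (hr : D.Reduced)
    {v : D.Crossing} (h : c.CrossingAnnulus b A (insert v A)) (hv : v ∉ A)
    (hA : c.BoundsDisk A) (hB : b.BoundsDisk (insert v A)) (hA4 : 4 ≤ D.cutSize A)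
    (hB4 : 4 ≤ D.cutSize (insert v A)) {X : Set D.Crossing} (hAX : A ⊆ X) (hvX : v ∉ X) :
    2 < D.cutSize X := by
  by_contra! hX
  obtain ⟨e, e', hne, ⟨hev, heA⟩, hev', heA'⟩ :=
    exists_two_edges_of_insert ha hr hv hA4 hB.cutSize_le
  have hsub : {D.opp e, D.opp e'} ⊆ D.cutDarts X := by
    rintro x (rfl | rfl)
    · exact ⟨hAX heA, by rwa [D.opp_opp, hev]⟩
    · exact ⟨hAX heA', by rwa [D.opp_opp, hev']⟩
  have hcut : {D.opp e, D.opp e'} = D.cutDarts X := by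
    refine Set.eq_of_subset_of_ncard_le hsub ?_
    rw [Set.ncard_pair fun h => hne (D.opp.injective h)]
    exact hX
  rcases D.eq_of_crossing_eq (hev.trans hev'.symm) with rfl | rfl | rfl | h3
  · exact hne rfl
  · exact not_reduced_of_cutDarts_eq hcut.symm hr
  · have hcE := hA.edgeInjective_and_tight hA4
    have hbE := hB.edgeInjective_and_tight hB4
    have hmem : D.opp e ∈ D.cutDarts A := ⟨heA, by rwa [D.opp_opp, hev]⟩
    obtain ⟨k, hk⟩ := hA.nonempty_hits (d := D.opp e) fun h => hmem.2 (h.1 hmem.1)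
    have hm : c.Meets (D.opp e, c.coord (D.opp e) k) := c.meets_iff.2 ⟨k, hk, rfl⟩
    have hi : c.InDisk A (D.opp e, c.coord (D.opp e) k) := by
      refine (inDisk_iff_crossing_mem fun u hu hmu => ?_).2 heA
      exact hu.ne (hcE.1.eq_of_meets hmu hm)
    rcases h.2.2 _ hm hi with ⟨t, _, ht, _⟩ | ⟨_, t, ht, _⟩
    · obtain ⟨l, hl, _⟩ := b.meets_iff.1 ht
      refine hbE.2 _ ⟨l, hl⟩ ⟨fun _ => Or.inl ?_, fun _ => Or.inr heA⟩
      rw [D.opp_opp, hev]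
    · obtain ⟨l, hl, _⟩ := b.meets_iff.1 ht
      rw [D.opp_opp] at hl
      exact hbE.2 _ ⟨l, hl⟩ ⟨fun _ => Or.inr heA', fun _ => Or.inl hev'⟩
  · have h4 : D.rot e' = e := by rw [h3, D.rot_four]
    refine not_reduced_of_cutDarts_eq (e := e') (X := X) ?_ hr
    rw [h4, ← hcut, Set.pair_comm]

/-- A set of crossings that splits a rational tangle is separated from its complement by more than
two edges. -/
theorem BoundsRational.two_lt_cutSize [Finite δ] (ha : D.Alternating) (hr : D.Reduced)
    (h : b.BoundsRational B) (hB4 : 4 ≤ D.cutSize B) {X : Set D.Crossing}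
    (h1 : (X ∩ B).Nonempty) (h2 : (B \ X).Nonempty) : 2 < D.cutSize X := by
  induction h with
  | trivial c _ => exact absurd h1 (by simp)
  | surround c b A B hc hb hann ih =>
    obtain ⟨v, hv, rfl⟩ := hann.2.1
    have hA := hc.boundsDisk
    rcases A.eq_empty_or_nonempty with rfl | hne
    · obtain ⟨w, hw, hw'⟩ := h1
      obtain ⟨z, hz, hz'⟩ := h2
      simp only [insert_empty_eq, Set.mem_singleton_iff] at hw' hz
      exact absurd (hz.trans hw'.symm ▸ hw) hz'
    have hA4 := hann.four_le_cutSize hA (hc.clear ha hr hne) (hb.edgeInjective_and_tight hB4).2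
    -- If `X` does not split `A`, then `X` or its complement contains `A`, and that set misses `v`
    -- because `X` splits `insert v A`.
    by_cases h3 : (X ∩ A).Nonempty
    · by_cases h4 : (A \ X).Nonempty
      · exact ih hA4 h3 h4
      · have hAX : A ⊆ X := Set.sdiff_eq_empty.1 (Set.not_nonempty_iff_eq_empty.1 h4)
        refine hann.two_lt_cutSize_of_subset ha hr hv hA hb hA4 hB4 hAX fun hvX => ?_
        obtain ⟨z, rfl | hz, hz'⟩ := h2
        · exact hz' hvX
        · exact hz' (hAX hz)
    · have hAX : A ⊆ Xᶜ := fun w hw hwX => h3 ⟨w, hwX, hw⟩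
      rw [← cutSize_compl]
      refine hann.two_lt_cutSize_of_subset ha hr hv hA hb hA4 hB4 hAX fun hvX => ?_
      obtain ⟨z, hzX, rfl | hz⟩ := h1
      · exact hvX hzX
      · exact hAX hz hzX

end LinkDiagram.PPPPCurve

/-! ### Contraction of the tangles to an octahedron, and classification of small cuts. -/

namespace LinkDiagram

variable {δ : Type*} {D : LinkDiagram δ}

/-- Curves that are disjoint and outside each other's disks bound disks without common
crossings. -/
theorem PPPPCurve.disjoint_of_not_inDisk {b₁ b₂ : D.PPPPCurve} {B₁ B₂ : Set D.Crossing}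
    (h₁ : b₁.BoundsDisk B₁) (h₂ : b₂.BoundsDisk B₂) (h₁₂ : ∀ p, b₁.Meets p → ¬ b₂.InDisk B₂ p)
    (h₂₁ : ∀ p, b₂.Meets p → ¬ b₁.InDisk B₁ p) (hne : B₁ ≠ Set.univ) : _root_.Disjoint B₁ B₂ := by
  rw [Set.disjoint_iff_inter_eq_empty]
  by_contra hX
  have hX' : B₁ ∩ B₂ ≠ Set.univ := fun h =>
    hne (Set.eq_univ_of_univ_subset (h ▸ Set.inter_subset_left))
  have hcut : (D.cutDarts (B₁ ∩ B₂)).Nonempty := by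
    by_contra h
    exact (eq_univ_or_empty_of_cutDarts_eq_empty (Set.not_nonempty_iff_eq_empty.1 h)).elim hX hX'
  obtain ⟨d, ⟨hd1, hd2⟩, hd⟩ := hcut
  let M : Set ℝ := {u | b₁.Meets (d, u) ∨ b₂.Meets (d, u)}
  have hfin : M.Finite := by
    refine ((Set.finite_range (b₁.coord d)).union (Set.finite_range (b₂.coord d))).subset ?_
    rintro u (hu | hu)
    · obtain ⟨k, _, hk⟩ := b₁.meets_iff.1 hu
      exact Or.inl ⟨k, hk⟩
    · obtain ⟨k, _, hk⟩ := b₂.meets_iff.1 hu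
      exact Or.inr ⟨k, hk⟩
  have hMne : M.Nonempty := by
    by_cases h : D.crossing (D.opp d) ∈ B₁
    · obtain ⟨k, hk⟩ := h₂.nonempty_hits (d := d) fun h' => hd ⟨h, h'.1 hd2⟩
      exact ⟨_, Or.inr (b₂.meets_iff.2 ⟨k, hk, rfl⟩)⟩
    · obtain ⟨k, hk⟩ := h₁.nonempty_hits (d := d) fun h' => h (h'.1 hd1)
      exact ⟨_, Or.inl (b₁.meets_iff.2 ⟨k, hk, rfl⟩)⟩
  -- On an edge leaving `B₁ ∩ B₂`, the first point on either curve still lies in the disk of the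
  -- other curve.
  obtain ⟨u, hu, hmin⟩ := Set.exists_min_image M id hfin hMne
  rcases hu with hu | hu
  · exact h₁₂ _ hu ((PPPPCurve.inDisk_iff_crossing_mem fun w hw hm =>
      (hmin w (Or.inr hm)).not_gt hw).2 hd2)
  · exact h₂₁ _ hu ((PPPPCurve.inDisk_iff_crossing_mem fun w hw hm =>
      (hmin w (Or.inl hm)).not_gt hw).2 hd1)

/-- The number of edges between different parts of a partition of the vertices of the octahedron;
`n` and `s` are opposite vertices and `t` lists the other vertices cyclically. -/
def octahedronCut (t : ZMod 4 → Bool) (n s : Bool) : ℕ :=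
  (Finset.univ.filter fun i => t i ≠ s).card + (Finset.univ.filter fun i => t i ≠ t (i + 1)).card +
    (Finset.univ.filter fun i => t i ≠ n).card

theorem four_le_octahedronCut : ∀ (t : ZMod 4 → Bool) (n s : Bool), octahedronCut t n s < 4 →
    (∀ i, t i = n) ∧ s = n := by decide

theorem octahedronCut_le_four : ∀ (t : ZMod 4 → Bool) (n s : Bool), octahedronCut t n s ≤ 4 →
    ((∀ i, t i = n) ∧ s = n) ∨ ((∀ i, t i = n) ∧ s = !n) ∨ ((∀ i, t i = s) ∧ s = !n) ∨
      (s = n ∧ ∃ i, t i = !n ∧ ∀ j, j ≠ i → t j = n) := by decide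

/-- Sets with cut at most four are empty, single vertices, and their complements. Two such sets that
contain the pole `n` and differ exactly in the vertex `i` can only be everything and the complement
of `i`. -/
theorem octahedronCut_update : ∀ (t : ZMod 4 → Bool) (s : Bool) (i : ZMod 4),
    octahedronCut (Function.update t i false) true s ≤ 4 →
    octahedronCut (Function.update t i true) true s ≤ 4 →
    (∀ j, Function.update t i true j = true) ∧ s = true := by decide

namespace StandardPseudoMontesinos

variable (P : D.StandardPseudoMontesinos)

theorem north_notMem (i : ZMod 4) : P.north ∉ P.T i := (P.exterior _).2 (Or.inl rfl) i

theorem south_notMem (i : ZMod 4) : P.south ∉ P.T i := (P.exterior _).2 (Or.inr rfl) i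

theorem T_ne_univ (i : ZMod 4) : P.T i ≠ Set.univ :=
  fun h => P.north_notMem i (h ▸ Set.mem_univ _)

theorem T_disjoint {i j : ZMod 4} (hij : i ≠ j) : Disjoint (P.T i) (P.T j) := by
  have key : ∀ i j, i ≠ j → ∀ p, (P.Q i).Meets p → ¬ (P.Q j).InDisk (P.T j) p := by
    rintro i j hij p ⟨k, hk⟩
    obtain ⟨h1, h2⟩ := P.disjoint j i hij.symm
    rcases hk with rfl | rfl
    · exact h2 k
    · rw [PPPPCurve.inDisk_flip_of_not_meets (P.bounds j)
        fun hm => h1.not_meets hm (PPPPCurve.meets_point k)]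
      exact h2 k
  exact PPPPCurve.disjoint_of_not_inDisk (P.bounds i) (P.bounds j) (key i j hij)
    (key j i hij.symm) (P.T_ne_univ i)

theorem eq_of_mem {i j : ZMod 4} {v : D.Crossing} (hi : v ∈ P.T i) (hj : v ∈ P.T j) : i = j := by
  by_contra h
  exact Set.disjoint_left.1 (P.T_disjoint h) hi hj

theorem clear (i : ZMod 4) : (P.Q i).Clear (P.T i) :=
  (P.rational i).clear P.alternating P.reduced (P.nonempty i)

theorem crossing_dart_mem (i k : ZMod 4) : D.crossing ((P.Q i).dart k) ∈ P.T i :=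
  (P.clear i).crossing_mem (PPPPCurve.meets_point k) (P.outward i k)

theorem crossing_opp_dart_zero (i : ZMod 4) : D.crossing (D.opp ((P.Q i).dart 0)) = P.south :=
  (P.to_south i).1

theorem crossing_opp_dart_two (i : ZMod 4) : D.crossing (D.opp ((P.Q i).dart 2)) = P.north :=
  (P.to_north i).1

theorem crossing_opp_dart_one_mem (i : ZMod 4) :
    D.crossing (D.opp ((P.Q i).dart 1)) ∈ P.T (i + 1) := by
  rw [← (P.next i).1]
  exact P.crossing_dart_mem _ _

theorem crossing_opp_dart_three_mem (i : ZMod 4) :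
    D.crossing (D.opp ((P.Q i).dart 3)) ∈ P.T (i - 1) := by
  have h := (P.next (i - 1)).1
  rw [sub_add_cancel] at h
  rw [h, D.opp_opp]
  exact P.crossing_dart_mem _ _

theorem crossing_opp_dart_notMem (i k : ZMod 4) : D.crossing (D.opp ((P.Q i).dart k)) ∉ P.T i := by
  have hk : ∀ k : ZMod 4, k = 0 ∨ k = 1 ∨ k = 2 ∨ k = 3 := by decide
  rcases hk k with rfl | rfl | rfl | rfl
  · rw [crossing_opp_dart_zero]
    exact P.south_notMem i
  · intro h
    have := P.eq_of_mem h (P.crossing_opp_dart_one_mem i)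
    clear h
    revert this
    revert i
    decide
  · rw [crossing_opp_dart_two]
    exact P.north_notMem i
  · intro h
    have := P.eq_of_mem h (P.crossing_opp_dart_three_mem i)
    clear h
    revert this
    revert i
    decide

theorem cutSize_T [Finite δ] (i : ZMod 4) : D.cutSize (P.T i) = 4 := by
  refine le_antisymm (P.bounds i).cutSize_le ((P.clear i).four_le_cutSize (P.bounds i) ?_)
  rintro p ⟨k, hk⟩ hp
  rw [(P.bounds i).outward_unique hk hp (Or.inl rfl) (P.outward i k)]
  exact P.crossing_opp_dart_notMem i k

theorem edgeInjective [Finite δ] (i : ZMod 4) : (P.Q i).EdgeInjective :=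
  ((P.bounds i).edgeInjective_and_tight (P.cutSize_T i).ge).1

theorem dart_injective [Finite δ] {i j k : ZMod 4} (h : (P.Q i).dart j = (P.Q i).dart k) : j = k :=
  P.edgeInjective i _ _ _ (PPPPCurve.mem_hits_dart j) (Or.inl h.symm)

/-- The edges between the tangles and the exterior crossings. -/
def outerDart (z : ZMod 4 × Fin 3) : δ := (P.Q z.1).dart (z.2 : ℕ)

theorem crossing_outerDart_mem (z : ZMod 4 × Fin 3) : D.crossing (P.outerDart z) ∈ P.T z.1 :=
  P.crossing_dart_mem _ _

theorem outerDart_injective [Finite δ] : Function.Injective P.outerDart := by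
  rintro ⟨i, a⟩ ⟨j, b⟩ h
  have h1 := P.crossing_outerDart_mem ⟨i, a⟩
  rw [h] at h1
  obtain rfl := P.eq_of_mem h1 (P.crossing_outerDart_mem _)
  have h2 := P.dart_injective h
  have : ∀ a b : Fin 3, ((a : ℕ) : ZMod 4) = (b : ℕ) → a = b := by decide
  rw [this a b h2]

/-- No edge is listed from both ends, because index `3` is left out: it names the edge that index
`1` of the preceding tangle already names. -/
theorem outerDart_ne_opp [Finite δ] (z w : ZMod 4 × Fin 3) :
    P.outerDart z ≠ D.opp (P.outerDart w) := by
  intro h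
  obtain ⟨j, b⟩ := w
  have h1 := P.crossing_outerDart_mem z
  have hb : ∀ b : Fin 3, b = 0 ∨ b = 1 ∨ b = 2 := by decide
  rcases hb b with rfl | rfl | rfl
  · rw [h] at h1
    exact P.south_notMem _ (P.crossing_opp_dart_zero j ▸ h1)
  · have h2 : P.outerDart z = (P.Q (j + 1)).dart 3 := h.trans (P.next j).1.symm
    rw [h2] at h1
    have h3 := P.eq_of_mem h1 (P.crossing_dart_mem _ _)
    unfold outerDart at h2
    rw [h3] at h2
    have := P.dart_injective h2
    revert this
    generalize z.2 = a
    revert a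
    decide
  · rw [h] at h1
    exact P.north_notMem _ (P.crossing_opp_dart_two j ▸ h1)

theorem ncard_outerDart_le [Finite δ] (X : Set D.Crossing) :
    {z | ¬ (D.crossing (P.outerDart z) ∈ X ↔ D.crossing (D.opp (P.outerDart z)) ∈ X)}.ncard ≤
      D.cutSize X := by
  classical
  refine Set.ncard_le_ncard_of_injOn (fun z => if D.crossing (P.outerDart z) ∈ X then
    P.outerDart z else D.opp (P.outerDart z)) (fun z hz => ?_) (fun z _ w _ hzw => ?_)
  · rw [Set.mem_ofPred_eq] at hz
    split_ifs with h
    · exact ⟨h, fun h' => hz ⟨fun _ => h', fun _ => h⟩⟩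
    · refine ⟨?_, by rwa [D.opp_opp]⟩
      by_contra h'
      exact hz ⟨fun h'' => absurd h'' h, fun h'' => absurd h'' h'⟩
  · dsimp only at hzw
    split_ifs at hzw
    · exact P.outerDart_injective hzw
    · exact (P.outerDart_ne_opp _ _ hzw).elim
    · exact (P.outerDart_ne_opp _ _ hzw.symm).elim
    · exact P.outerDart_injective (D.opp.injective hzw)

/-- A set of crossings that splits no tangle is a set of vertices of an octahedron. -/
theorem octahedronCut_le_cutSize [Finite δ] {X : Set D.Crossing} {t : ZMod 4 → Bool} {n s : Bool}
    (ht : ∀ i, ∀ v ∈ P.T i, (v ∈ X ↔ t i = true)) (hn : P.north ∈ X ↔ n = true)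
    (hs : P.south ∈ X ↔ s = true) : octahedronCut t n s ≤ D.cutSize X := by
  classical
  refine le_trans ?_ (P.ncard_outerDart_le X)
  have hb : ∀ a b : Bool, a ≠ b ↔ ¬ (a = true ↔ b = true) := by decide
  let S : Fin 3 → Finset (ZMod 4) := ![Finset.univ.filter fun i => t i ≠ s,
    Finset.univ.filter fun i => t i ≠ t (i + 1), Finset.univ.filter fun i => t i ≠ n]
  have hS : octahedronCut t n s = (Finset.univ.biUnion fun a : Fin 3 =>
      (S a).image fun i => (i, a)).card := by
    rw [Finset.card_biUnion]
    · simp only [Finset.card_image_of_injective _ (Prod.mk_left_injective _), Fin.sum_univ_three]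
      rfl
    · intro a _ b _ hab
      rw [Function.onFun, Finset.disjoint_left]
      simp only [Finset.mem_image]
      rintro _ ⟨i, _, rfl⟩ ⟨j, _, hj⟩
      exact hab (congrArg Prod.snd hj).symm
  rw [hS, ← Set.ncard_coe_finset]
  refine Set.ncard_le_ncard ?_
  rintro ⟨i, a⟩ hia
  simp only [Finset.coe_biUnion, Set.mem_iUnion, Finset.mem_coe, Finset.mem_image,
    Finset.mem_univ] at hia
  obtain ⟨b, _, j, hj, hjb⟩ := hia
  obtain ⟨rfl, rfl⟩ := Prod.mk.inj hjb
  rw [Set.mem_ofPred_eq, ht _ _ (P.crossing_outerDart_mem _)]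
  have hcase : ∀ b : Fin 3, b = 0 ∨ b = 1 ∨ b = 2 := by decide
  rcases hcase b with rfl | rfl | rfl
  · rw [show D.crossing (D.opp (P.outerDart (j, 0))) = P.south from P.crossing_opp_dart_zero j,
      hs, ← hb]
    simpa [S] using hj
  · rw [ht (j + 1) (D.crossing (D.opp (P.outerDart (j, 1)))) (P.crossing_opp_dart_one_mem j), ← hb]
    simpa [S] using hj
  · rw [show D.crossing (D.opp (P.outerDart (j, 2))) = P.north from P.crossing_opp_dart_two j,
      hn, ← hb]
    simpa [S] using hj

theorem eq_of_forall {p : D.Crossing → Prop} (hT : ∀ i, ∀ v ∈ P.T i, p v) (hn : p P.north)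
    (hs : p P.south) (v : D.Crossing) : p v := by
  by_cases h : ∃ i, v ∈ P.T i
  · obtain ⟨i, hi⟩ := h
    exact hT i v hi
  · rcases (P.exterior v).1 (not_exists.1 h) with rfl | rfl
    · exact hn
    · exact hs

/-- The set `X` splits the tangle `i`. -/
def Splits (X : Set D.Crossing) (i : ZMod 4) : Prop := (X ∩ P.T i).Nonempty ∧ (P.T i \ X).Nonempty

open Classical in
theorem mem_iff_of_not_splits {X : Set D.Crossing} {i : ZMod 4} (h : ¬ P.Splits X i)
    {v : D.Crossing} (hv : v ∈ P.T i) : v ∈ X ↔ decide (P.T i ⊆ X) = true := by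
  rw [decide_eq_true_iff]
  refine ⟨fun hvX w hw => ?_, fun h' => h' hv⟩
  by_contra hwX
  exact h ⟨⟨v, hvX, hv⟩, ⟨w, hw, hwX⟩⟩

/-- A standard diagram is prime. -/
theorem four_le_cutSize [Finite δ] (P : D.StandardPseudoMontesinos) {X : Set D.Crossing}
    (h1 : X.Nonempty) (h2 : Xᶜ.Nonempty) :
    4 ≤ D.cutSize X := by
  classical
  by_cases hsp : ∃ i, P.Splits X i
  · obtain ⟨i, hi⟩ := hsp
    have := (P.rational i).two_lt_cutSize P.alternating P.reduced (P.cutSize_T i).ge hi.1 hi.2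
    -- The cut is even and larger than two.
    obtain ⟨k, hk⟩ := even_cutSize X
    omega
  · rw [not_exists] at hsp
    by_contra! hlt
    have hle := P.octahedronCut_le_cutSize (X := X) (n := decide (P.north ∈ X))
      (s := decide (P.south ∈ X)) (fun i v hv => P.mem_iff_of_not_splits (hsp i) hv)
      (by simp) (by simp)
    obtain ⟨ht, hs⟩ := four_le_octahedronCut _ _ _ (hle.trans_lt hlt)
    have hall := P.eq_of_forall (p := fun v => v ∈ X ↔ P.north ∈ X)
      (fun i v hv => by
        rw [P.mem_iff_of_not_splits (hsp i) hv, ht i, decide_eq_true_iff]) Iff.rfl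
      (by simpa using hs)
    obtain ⟨v, hv⟩ := h1
    obtain ⟨w, hw⟩ := h2
    exact hw ((hall w).2 ((hall v).1 hv))

/-- Uncrossing: if `Y` splits `T j`, then `Y \ T j` and `T j \ Y` have cuts of total size at most `4
+ 4`, and the second has at least four by primeness. Removing `T j` from `Y` therefore keeps the
bound, and it affects neither `north` nor the other tangles. -/
theorem exists_not_splits [Finite δ] {X : Set D.Crossing} (hX : D.cutSize X ≤ 4) (hn : P.north ∈ X)
    (i : ZMod 4) (J : Finset (ZMod 4)) (hJ : i ∉ J) :
    ∃ Y ⊆ X, Y ∩ P.T i = X ∩ P.T i ∧ D.cutSize Y ≤ 4 ∧ P.north ∈ Y ∧ ∀ j ∈ J, ¬ P.Splits Y j := by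
  induction J using Finset.induction with
  | empty => exact ⟨X, subset_rfl, rfl, hX, hn, by simp⟩
  | insert j J hj ih =>
    obtain ⟨Y, h1, h2, h3, h4, h5⟩ := ih fun h => hJ (Finset.mem_insert_of_mem h)
    have hij : i ≠ j := fun h => hJ (h ▸ Finset.mem_insert_self _ _)
    by_cases hs : P.Splits Y j
    · refine ⟨Y \ P.T j, Set.sdiff_subset.trans h1, ?_, ?_, ⟨h4, P.north_notMem j⟩, ?_⟩
      · rw [← h2]
        ext v
        refine ⟨fun hv => ⟨hv.1.1, hv.2⟩, fun hv => ⟨⟨hv.1, fun hvj => ?_⟩, hv.2⟩⟩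
        exact hij (P.eq_of_mem hv.2 hvj)
      · have e1 := cutSize_diff_add_le Y (P.T j)
        have e2 := P.four_le_cutSize hs.2 ⟨P.north, fun h => P.north_notMem j h.1⟩
        rw [P.cutSize_T] at e1
        omega
      · intro k hk hsp
        rcases Finset.mem_insert.1 hk with rfl | hk
        · obtain ⟨⟨v, hv, hv'⟩, _⟩ := hsp
          exact hv.2 hv'
        · refine h5 k hk ⟨hsp.1.mono fun v hv => ⟨hv.1.1, hv.2⟩, ?_⟩
          obtain ⟨v, hv, hv'⟩ := hsp.2
          refine ⟨v, hv, fun hvY => hv' ⟨hvY, fun hvj => ?_⟩⟩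
          exact hj (P.eq_of_mem hv hvj ▸ hk)
    · refine ⟨Y, h1, h2, h3, h4, fun k hk => ?_⟩
      rcases Finset.mem_insert.1 hk with rfl | hk
      · exact hs
      · exact h5 k hk

/-- If four edges separate a set of crossings from its complement, and the set splits a tangle and
contains `north`, the complement is in the tangle. -/
theorem compl_subset_of_splits [Finite δ] {X : Set D.Crossing} (hX : D.cutSize X ≤ 4)
    (hn : P.north ∈ X)
    {i : ZMod 4} (hi : P.Splits X i) : Xᶜ ⊆ P.T i := by
  classical
  intro w hw
  by_contra hwT
  -- After uncrossing, `i` is the only tangle that `Y` splits. Then `Y ∪ P.T i` and `Y \ P.T i` both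
  -- have cut at most four and differ in one octahedron vertex, so the union is everything.
  obtain ⟨Y, hYX, hYi, hY4, hYn, hYs⟩ := P.exists_not_splits hX hn i (Finset.univ.erase i) (by simp)
  have hYi' : P.Splits Y i := by
    refine ⟨hYi ▸ hi.1, ?_⟩
    obtain ⟨v, hv, hv'⟩ := hi.2
    exact ⟨v, hv, fun h => hv' (hYX h)⟩
  have c1 : D.cutSize (Y ∪ P.T i) ≤ 4 := by
    have e1 := cutSize_add_le Y (P.T i)
    have e2 := P.four_le_cutSize hYi'.1 ⟨P.north, fun h => P.north_notMem i h.2⟩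
    rw [P.cutSize_T] at e1
    omega
  have c2 : D.cutSize (Y \ P.T i) ≤ 4 := by
    have e1 := cutSize_diff_add_le Y (P.T i)
    have e2 := P.four_le_cutSize hYi'.2 ⟨P.north, fun h => P.north_notMem i h.1⟩
    rw [P.cutSize_T] at e1
    omega
  let t : ZMod 4 → Bool := fun j => decide (P.T j ⊆ Y)
  have hmem : ∀ j ≠ i, ∀ v ∈ P.T j, (v ∈ Y ↔ t j = true) := fun j hj v hv =>
    P.mem_iff_of_not_splits (hYs j (by simp [hj])) hv
  have hni : ∀ j ≠ i, ∀ v ∈ P.T j, v ∉ P.T i := fun j hj v hv h => hj (P.eq_of_mem hv h)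
  have m1 : ∀ j, ∀ v ∈ P.T j, (v ∈ Y ∪ P.T i ↔ Function.update t i true j = true) := by
    intro j v hv
    by_cases hj : j = i
    · subst hj
      simp [hv]
    · rw [Function.update_of_ne hj, ← hmem j hj v hv, Set.mem_union, or_iff_left (hni j hj v hv)]
  have m2 : ∀ j, ∀ v ∈ P.T j, (v ∈ Y \ P.T i ↔ Function.update t i false j = true) := by
    intro j v hv
    by_cases hj : j = i
    · subst hj
      simp [hv]
    · rw [Function.update_of_ne hj, ← hmem j hj v hv, Set.mem_sdiff, and_iff_left (hni j hj v hv)]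
  have o1 := P.octahedronCut_le_cutSize (n := true) (s := decide (P.south ∈ Y)) m1
    (by simp [hYn]) (by simp [P.south_notMem])
  have o2 := P.octahedronCut_le_cutSize (n := true) (s := decide (P.south ∈ Y)) m2
    (by simp [hYn, P.north_notMem]) (by simp [P.south_notMem])
  obtain ⟨r1, r2⟩ := octahedronCut_update t _ i (o2.trans c2) (o1.trans c1)
  have hall := P.eq_of_forall (p := fun v => v ∈ Y ∪ P.T i) (fun j v hv => (m1 j v hv).2 (r1 j))
    (Or.inl hYn) (Or.inl (by simpa using r2))
  exact (hall w).elim (fun h => hw (hYX h)) hwT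

/-- A set of crossings that four edges separate from its complement is, up to passing to the
complement, contained in a tangle, or it consists of one of the exterior crossings. -/
theorem exists_subset_of_cutSize_le [Finite δ] {X : Set D.Crossing} (hX : D.cutSize X ≤ 4)
    (h1 : X.Nonempty) (h2 : Xᶜ.Nonempty) : ∃ Y, (Y = X ∨ Y = Xᶜ) ∧
      ((∃ i, Y ⊆ P.T i) ∨ Y = {P.north} ∨ Y = {P.south}) := by
  classical
  wlog hn : P.north ∈ X generalizing X
  · obtain ⟨Y, hY, h⟩ := this (X := Xᶜ) (by rwa [cutSize_compl]) h2 (by rwa [compl_compl]) hn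
    rw [compl_compl] at hY
    exact ⟨Y, hY.symm, h⟩
  by_cases hsp : ∃ i, P.Splits X i
  · obtain ⟨i, hi⟩ := hsp
    exact ⟨_, Or.inr rfl, Or.inl ⟨i, P.compl_subset_of_splits hX hn hi⟩⟩
  rw [not_exists] at hsp
  have hT : ∀ i, ∀ v ∈ P.T i, (v ∈ X ↔ decide (P.T i ⊆ X) = true) :=
    fun i v hv => P.mem_iff_of_not_splits (hsp i) hv
  have hle := P.octahedronCut_le_cutSize (n := true) (s := decide (P.south ∈ X)) hT
    (by simp [hn]) (by simp)
  have hall := fun p => P.eq_of_forall (p := p)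
  rcases octahedronCut_le_four _ _ _ (hle.trans hX) with ⟨ht, hs⟩ | ⟨ht, hs⟩ | ⟨ht, hs⟩ |
    ⟨hs, i, hi, ht⟩
  · obtain ⟨w, hw⟩ := h2
    exact (hw (hall (fun v => v ∈ X) (fun i v hv => (hT i v hv).2 (ht i)) hn (by simpa using hs)
      w)).elim
  · refine ⟨_, Or.inr rfl, Or.inr (Or.inr (Set.ext (hall _ (fun i v hv => ?_) ?_ ?_)))⟩
    · rw [Set.mem_compl_iff, hT i v hv, Set.mem_singleton_iff]
      refine iff_of_false (not_not.2 (ht i)) ?_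
      rintro rfl
      exact P.south_notMem i hv
    · exact iff_of_false (not_not.2 hn) P.north_ne_south
    · exact iff_of_true (by simpa using hs) rfl
  · refine ⟨_, Or.inl rfl, Or.inr (Or.inl (Set.ext (hall _ (fun i v hv => ?_) ?_ ?_)))⟩
    · rw [hT i v hv, ht i, Set.mem_singleton_iff]
      refine iff_of_false (by simp [hs]) ?_
      rintro rfl
      exact P.north_notMem i hv
    · exact iff_of_true hn rfl
    · exact iff_of_false (by simpa using hs) P.north_ne_south.symm
  · refine ⟨_, Or.inr rfl, Or.inl ⟨i, fun v hv => ?_⟩⟩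
    revert hv
    refine hall (fun v => v ∈ Xᶜ → v ∈ P.T i) (fun j v hv hvX => ?_) (fun h => (h hn).elim)
      (fun h => (h (by simpa using hs)).elim) v
    by_cases hj : j = i
    · exact hj ▸ hv
    · exact (hvX ((hT j v hv).2 (ht j hj))).elim

end StandardPseudoMontesinos

end LinkDiagram

/-! ### Chords of faces under motion of their end points. -/

namespace LinkDiagram

variable {δ : Type*} {D : LinkDiagram δ}

/-- For points on three different darts, the cyclic order on the face boundary is that of the darts:
the integers `0 < m < n` and the period are far enough apart to absorb any coordinates in the unit
interval. -/
theorem Btw.congr {a p b a' p' b' : δ × ℝ} (h : D.Btw a p b) (ha : a'.1 = a.1) (hp : p'.1 = p.1)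
    (hb : b'.1 = b.1) (hap : a.1 ≠ p.1) (hab : a.1 ≠ b.1) (hpb : p.1 ≠ b.1)
    (ha2 : a.2 ∈ Set.Ioo (0 : ℝ) 1) (hp2 : p.2 ∈ Set.Ioo (0 : ℝ) 1) (hb2 : b.2 ∈ Set.Ioo (0 : ℝ) 1)
    (ha2' : a'.2 ∈ Set.Ioo (0 : ℝ) 1) (hp2' : p'.2 ∈ Set.Ioo (0 : ℝ) 1)
    (hb2' : b'.2 ∈ Set.Ioo (0 : ℝ) 1) : D.Btw a' p' b' := by
  obtain ⟨m, n, hm, hn, h1, h2, h3⟩ := h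
  obtain ⟨ha0, ha1⟩ := ha2
  obtain ⟨hp0, hp1⟩ := hp2
  obtain ⟨hb0, hb1⟩ := hb2
  obtain ⟨ha0', ha1'⟩ := ha2'
  obtain ⟨hp0', hp1'⟩ := hp2'
  obtain ⟨hb0', hb1'⟩ := hb2'
  have m0 : m ≠ 0 := by
    rintro rfl
    exact hap hm.symm
  have mn : m ≠ n := by
    rintro rfl
    exact hpb (hm.trans hn.symm)
  have nN : n ≠ Function.minimalPeriod D.faceNext a.1 := by
    rintro rfl
    rw [Function.iterate_minimalPeriod] at hn
    exact hab hn.symm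
  have mn' : m < n + 1 := by
    have : (m : ℝ) < n + 1 := by linarith
    exact_mod_cast this
  have nN' : n < Function.minimalPeriod D.faceNext a.1 + 1 := by
    have : (n : ℝ) < Function.minimalPeriod D.faceNext a.1 + 1 := by linarith
    exact_mod_cast this
  have l1 : (1 : ℝ) ≤ m := by exact_mod_cast Nat.one_le_iff_ne_zero.2 m0
  have l2 : (m : ℝ) + 1 ≤ n := by exact_mod_cast (show m + 1 ≤ n by omega)
  have l3 : (n : ℝ) + 1 ≤ Function.minimalPeriod D.faceNext a.1 := by
    exact_mod_cast (show n + 1 ≤ Function.minimalPeriod D.faceNext a.1 by omega)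
  refine ⟨m, n, by rw [hp, ha, hm], by rw [hb, ha, hn], by linarith, by linarith, ?_⟩
  rw [ha]
  linarith

namespace PPPPCurve

variable {c b : D.PPPPCurve}

theorem EdgeInjective.eq (hc : c.EdgeInjective) {j k : ZMod 4} (h : c.dart j = c.dart k) : j = k :=
  hc _ _ _ (mem_hits_dart j) (Or.inl h.symm)

theorem EdgeInjective.ne_opp (hc : c.EdgeInjective) (j k : ZMod 4) :
    c.dart j ≠ D.opp (c.dart k) := by
  intro h
  have h1 : j = k := hc _ j k (mem_hits_dart j) (Or.inr (by rw [h, D.opp_opp]))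
  rw [h1] at h
  exact D.opp_ne _ h.symm

theorem add_one_ne (j : ZMod 4) : j + 1 ≠ j := by
  revert j
  decide

/-- The points of a curve that meets every edge at most once can be moved freely along the open
edges. -/
def EdgeInjective.move (hc : c.EdgeInjective) (pos : ZMod 4 → ℝ)
    (hpos : ∀ k, pos k ∈ Set.Ioo (0 : ℝ) 1) : D.PPPPCurve where
  dart := c.dart
  pos := pos
  pos_mem := hpos
  same_face := c.same_face
  points_ne j k hjk := ⟨fun h => hjk (hc.eq (congrArg Prod.fst h)),
    fun h => hc.ne_opp j k (congrArg Prod.fst h)⟩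
  -- End points of different chords lie on different darts, so a crossing would persist when the
  -- points are moved back to `c`.
  simple j k hjk hcross := by
    have e1 : D.opp (c.dart j) ≠ c.dart (j + 1) := (hc.ne_opp _ _).symm
    have e2 : D.opp (c.dart j) ≠ D.opp (c.dart k) := fun h => hjk (hc.eq (D.opp.injective h))
    have e3 : D.opp (c.dart j) ≠ c.dart (k + 1) := (hc.ne_opp _ _).symm
    have e4 : c.dart (j + 1) ≠ D.opp (c.dart k) := hc.ne_opp _ _
    have e5 : c.dart (j + 1) ≠ c.dart (k + 1) := fun h => hjk (add_right_cancel (hc.eq h))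
    have i1 : ∀ {x : ℝ}, x ∈ Set.Ioo (0 : ℝ) 1 → 1 - x ∈ Set.Ioo (0 : ℝ) 1 := fun {x} hx =>
      ⟨by linarith [hx.2], by linarith [hx.1]⟩
    have i2 := c.pos_mem
    refine c.simple j k hjk ?_
    rcases hcross with ⟨h1, h2⟩ | ⟨h1, h2⟩
    · exact Or.inl ⟨h1.congr rfl rfl rfl e2 e1 e4.symm (i1 (hpos j)) (i1 (hpos k)) (hpos _)
        (i1 (i2 j)) (i1 (i2 k)) (i2 _), h2.congr rfl rfl rfl e5 e1.symm e3.symm (hpos _) (hpos _)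
        (i1 (hpos j)) (i2 _) (i2 _) (i1 (i2 j))⟩
    · exact Or.inr ⟨h1.congr rfl rfl rfl e3 e1 e5.symm (i1 (hpos j)) (hpos _) (hpos _)
        (i1 (i2 j)) (i2 _) (i2 _), h2.congr rfl rfl rfl e4 e1.symm e2.symm (hpos _) (i1 (hpos k))
        (i1 (hpos j)) (i2 _) (i1 (i2 k)) (i1 (i2 j))⟩

theorem EdgeInjective.strongIsotopic_move (hc : c.EdgeInjective) (pos : ZMod 4 → ℝ)
    (hpos : ∀ k, pos k ∈ Set.Ioo (0 : ℝ) 1) : c.StrongIsotopic (hc.move pos hpos) := by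
  refine ⟨fun t => hc.move (fun k => (1 - (t : ℝ)) * c.pos k + t * pos k) fun k => ?_, ?_, ?_,
    fun _ => rfl, ?_⟩
  · exact convex_Ioo (0 : ℝ) 1 (c.pos_mem k) (hpos k) (by linarith [t.2.2]) t.2.1 (by ring)
  · ext k
    · rfl
    · simp [move]
  · ext k
    · rfl
    · simp [move]
  · simp only [move]
    fun_prop

variable (c) in
theorem strongIsotopic_refl : c.StrongIsotopic c :=
  ⟨fun _ => c, rfl, rfl, fun _ => rfl, continuous_const⟩

end PPPPCurve

theorem iff_of_forall_iff_succ {y : ℕ → Prop} {a m : ℕ} (ham : a ≤ m)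
    (h : ∀ i, a ≤ i → i < m → (y i ↔ y (i + 1))) : y a ↔ y m := by
  induction m, ham using Nat.le_induction with
  | base => rfl
  | succ m ham ih => exact (ih fun i h1 h2 => h i h1 (by omega)).trans (h m ham (by omega))

/-- Let `p` and `q` be points of the boundary of a face that are close to crossings in `T`, and
let `r` and `s` be points on the only edges of this face with exactly one end in `T`. Then
`r` and `s` do not separate `p` and `q`. -/
theorem not_btw_of_near {T : Set D.Crossing} {ε : ℝ} {p q r s : δ × ℝ} (hpq : p.1 ≠ q.1)
    (hp : (D.crossing p.1 ∈ T ∧ p.2 = ε) ∨ (D.crossing (D.opp p.1) ∈ T ∧ p.2 = 1 - ε))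
    (hq : (D.crossing q.1 ∈ T ∧ q.2 = ε) ∨ (D.crossing (D.opp q.1) ∈ T ∧ q.2 = 1 - ε))
    (hε : 0 < ε) (hr : r.2 ∈ Set.Ioo ε (1 - ε)) (hs : s.2 ∈ Set.Ioo ε (1 - ε))
    (hcut : ¬ (D.crossing r.1 ∈ T ↔ D.crossing (D.opp r.1) ∈ T))
    (huniq : ∀ y, D.face y = D.face r.1 → ¬ (D.crossing y ∈ T ↔ D.crossing (D.opp y) ∈ T) →
      y = r.1 ∨ y = s.1)
    (h1 : D.Btw p r q) (h2 : D.Btw q s p) : False := by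
  obtain ⟨m, n, hm, hn, a1, a2, a3⟩ := h1
  obtain ⟨m', n', hm', hn', b1, b2, b3⟩ := h2
  obtain ⟨hr0, hr1⟩ := hr
  obtain ⟨hs0, hs1⟩ := hs
  set f : δ → δ := ⇑D.faceNext with hf
  set N := Function.minimalPeriod f p.1 with hN
  have hp2 : ε ≤ p.2 ∧ p.2 ≤ 1 - ε := by
    rcases hp with ⟨_, h⟩ | ⟨_, h⟩ <;> constructor <;> linarith
  have hq2 : ε ≤ q.2 ∧ q.2 ≤ 1 - ε := by
    rcases hq with ⟨_, h⟩ | ⟨_, h⟩ <;> constructor <;> linarith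
  have cast_lt : ∀ {i j : ℕ}, (i : ℝ) < j + 1 → i ≤ j := fun {i j} h => by
    have : i < j + 1 := by exact_mod_cast h
    omega
  have n0 : n ≠ 0 := by
    rintro rfl
    exact hpq hn.symm
  have nN : n ≠ N := by
    rintro rfl
    rw [hN, Function.iterate_minimalPeriod] at hn
    exact hpq hn.symm
  have mn : m ≤ n := cast_lt (by linarith)
  have nN' : n ≤ N := cast_lt (by linarith)
  have hper : p.1 ∈ Function.periodicPts f :=
    Function.minimalPeriod_pos_iff_mem_periodicPts.1 (by omega)
  have hN' : Function.minimalPeriod f q.1 = N := by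
    rw [hn, Function.minimalPeriod_apply_iterate hper]
  rw [hN'] at b3
  have n0' : n' ≠ 0 := by
    rintro rfl
    exact hpq hn'
  have nN1 : n' ≠ N := by
    rintro rfl
    rw [← hN', Function.iterate_minimalPeriod] at hn'
    exact hpq hn'
  have mn1 : m' ≤ n' := cast_lt (by linarith)
  have nN1' : n' ≤ N := cast_lt (by linarith)
  -- The walk from `p` to `q` followed by the walk from `q` to `p` goes around the face exactly
  -- once.
  have hsum : n' + n = N := by
    have h : Function.IsPeriodicPt f (n' + n) p.1 := by
      rw [Function.IsPeriodicPt, Function.IsFixedPt, Function.iterate_add_apply, ← hn, ← hn']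
    obtain ⟨k, hk⟩ := h.minimalPeriod_dvd
    rw [← hN] at hk
    have k1 : k < 2 := by
      by_contra hk2
      have : N * 2 ≤ N * k := Nat.mul_le_mul_left _ (by omega)
      omega
    have k2 : k ≠ 0 := by
      rintro rfl
      omega
    obtain rfl : k = 1 := by omega
    omega
  have hsucc : ∀ i, D.crossing (f^[i + 1] p.1) = D.crossing (D.opp (f^[i] p.1)) := fun i => by
    rw [Function.iterate_succ_apply', hf, crossing_faceNext]
  have hface : ∀ i, D.face (f^[i] p.1) = D.face p.1 := fun i => by
    induction i with
    | zero => rfl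
    | succ i ih => rw [Function.iterate_succ_apply', hf, face_faceNext, ← hf, ih]
  -- Membership in `T` along the successive crossings of the face, starting at `p`. The walk from
  -- `p` to `q` begins and ends in `T` and changes at `r`, so it changes a second time; this can
  -- only happen at `s`, which however lies on the way back.
  let y : ℕ → Prop := fun i => D.crossing (f^[i] p.1) ∈ T
  -- The index is `0` or `1` according to which end of its edge `p` is close to; likewise `n` or `n
  -- + 1` for `q`.
  have hstart : ∃ a, a ≤ m ∧ y a ∧ (a = 0 → p.2 = ε) := by
    rcases hp with ⟨h, h'⟩ | ⟨h, h'⟩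
    · exact ⟨0, by omega, h, fun _ => h'⟩
    · have hy1 : y (0 + 1) := by
        simp only [y, hsucc]
        exact h
      refine ⟨1, ?_, hy1, by simp⟩
      rw [Nat.one_le_iff_ne_zero]
      rintro rfl
      norm_num at a1
      linarith
  have hend : ∃ e, m < e ∧ e ≤ n + 1 ∧ y e ∧ (e = n + 1 → q.2 = 1 - ε) := by
    rcases hq with ⟨h, h'⟩ | ⟨h, h'⟩
    · refine ⟨n, ?_, by omega, by simpa only [y, ← hn] using h, by omega⟩
      refine lt_of_le_of_ne mn ?_
      rintro rfl
      linarith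
    · exact ⟨n + 1, by omega, le_rfl, by simpa only [y, hsucc, ← hn] using h, fun _ => h'⟩
  obtain ⟨a, ham, hya, ha⟩ := hstart
  obtain ⟨e, hme, hen, hye, he⟩ := hend
  have hym : ¬ (y m ↔ y (m + 1)) := by
    simp only [y, hsucc]
    rwa [← hm]
  obtain ⟨i, hai, hie, him, hi⟩ : ∃ i, a ≤ i ∧ i < e ∧ i ≠ m ∧ ¬ (y i ↔ y (i + 1)) := by
    by_contra! hno
    have e1 := iff_of_forall_iff_succ (y := y) ham fun i h1 h2 => hno i h1 (by omega) (by omega)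
    have e2 := iff_of_forall_iff_succ (y := y) (a := m + 1) (m := e) hme
      fun i h1 h2 => hno i (by omega) h2 (by omega)
    exact hym ⟨fun _ => e2.2 hye, fun _ => e1.1 hya⟩
  have hinj : ∀ i j, i < N → j < N → f^[i] p.1 = f^[j] p.1 → i = j := fun i j h1 h2 h =>
    Function.iterate_injOn_Iio_minimalPeriod h1 h2 h
  have his : f^[i] p.1 = s.1 := by
    simp only [y, hsucc] at hi
    refine (huniq _ ?_ hi).resolve_left fun h => ?_
    · rw [hface, hm, hface]
    · exact him (hinj i m (by omega) (by omega) (h.trans hm))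
  rw [hm', hn, ← Function.iterate_add_apply] at his
  -- The remaining possibility is that `s` shares its dart with `q` or with `p`; then the margin `ε`
  -- contradicts the order of the coordinates.
  rcases (show m' + n ≤ N by omega).lt_or_eq with hlt | heq
  · have := hinj _ _ (by omega) hlt his
    obtain rfl : m' = 0 := by omega
    have := he (by omega)
    norm_num at b1
    linarith
  · rw [heq, hN, Function.iterate_minimalPeriod] at his
    have := hinj i 0 (by omega) (by omega) his
    have := ha (by omega)
    obtain rfl : m' = n' := by omega
    linarith

/-! ### Sliding curves into tangles, and exclusion of flypes around exterior crossings. -/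

namespace StandardPseudoMontesinos

variable (P : D.StandardPseudoMontesinos)

/-- A family of fewer than four darts that are crossed by closed curves contains every edge an
even number of times. -/
theorem not_odd_of_closed [Finite δ] (P : D.StandardPseudoMontesinos) {ι : Type*}
    [Finite ι] (hι : Nat.card ι < 4) (dart : ι → δ)
    (σ : Equiv.Perm ι) (h : ∀ i, D.face (D.opp (dart i)) = D.face (dart (σ i))) (x : δ) :
    ¬ Odd {i | dart i = x ∨ dart i = D.opp x}.ncard := by
  classical
  intro hodd
  obtain ⟨A, hA⟩ := exists_cut_of_closed dart σ h
  have hx := (hA x).1 hodd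
  -- Every edge leaving `A` carries a member of the family, so fewer than four edges leave `A`,
  -- against primeness.
  have hsub : D.cutDarts A ⊆ (fun i => if D.crossing (dart i) ∈ A then dart i else
      D.opp (dart i)) '' Set.univ := by
    rintro z ⟨hz, hz'⟩
    have hzo := (hA z).2 fun h => hz' (h.1 hz)
    obtain ⟨i, hi⟩ : {i | dart i = z ∨ dart i = D.opp z}.Nonempty :=
      Set.nonempty_of_ncard_ne_zero fun h0 => by simp [h0] at hzo
    refine ⟨i, trivial, ?_⟩
    rcases hi with rfl | hi
    · exact if_pos hz
    · simp only [hi, if_neg hz', D.opp_opp]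
  have h1 := (Set.ncard_le_ncard hsub).trans (Set.ncard_image_le)
  rw [Set.ncard_univ] at h1
  have h2 : 4 ≤ D.cutSize A := by
    by_cases hxA : D.crossing x ∈ A
    · exact P.four_le_cutSize ⟨_, hxA⟩ ⟨_, fun h => hx ⟨fun _ => h, fun _ => hxA⟩⟩
    · refine P.four_le_cutSize ⟨D.crossing (D.opp x), ?_⟩ ⟨_, hxA⟩
      by_contra h
      exact hx ⟨fun h' => absurd h' hxA, fun h' => absurd h' h⟩
  unfold cutSize at h2
  omega

/-- A curve that meets four different edges runs through four different faces. -/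
theorem eq_of_face_eq [Finite δ] (P : D.StandardPseudoMontesinos) {c : D.PPPPCurve}
    (hc : c.EdgeInjective) {j k : ZMod 4}
    (h : D.face (D.opp (c.dart j)) = D.face (D.opp (c.dart k))) : j = k := by
  have hface : ∀ k, D.face (D.opp (c.dart k)) = D.face (c.dart (k + 1)) := fun k =>
    face_eq_iff.2 (c.same_face k)
  -- A curve that visits a face twice can be closed up inside that face after one or two of its
  -- points, giving a closed curve with too few points.
  have h1 : ∀ j, D.face (D.opp (c.dart j)) ≠ D.face (D.opp (c.dart (j + 1))) := by
    intro j h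
    refine P.not_odd_of_closed (ι := Unit) (by simp) (fun _ => c.dart (j + 1)) (Equiv.refl _)
      (fun _ => by rw [← h, hface]) (c.dart (j + 1)) ?_
    simp
  have h2 : ∀ j, D.face (D.opp (c.dart j)) ≠ D.face (D.opp (c.dart (j + 2))) := by
    intro j h
    have e1 : c.dart (j + 1 + 1) ≠ c.dart (j + 1) :=
      fun h => PPPPCurve.add_one_ne (j + 1) (hc.eq h)
    have e2 := hc.ne_opp (j + 1 + 1) (j + 1)
    have e3 : j + 2 = j + 1 + 1 := by ring
    rw [e3] at h
    refine P.not_odd_of_closed (ι := Bool) (by simp)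
      (fun i => if i then c.dart (j + 1) else c.dart (j + 1 + 1)) Equiv.boolNot ?_
      (c.dart (j + 1)) ?_
    · rintro (_ | _)
      · simp [← h, hface]
      · simp [hface]
    · have : {i : Bool | (if i then c.dart (j + 1) else c.dart (j + 1 + 1)) = c.dart (j + 1) ∨
          (if i then c.dart (j + 1) else c.dart (j + 1 + 1)) = D.opp (c.dart (j + 1))} = {true} := by
        ext i
        cases i <;> simp [e1, e2]
      rw [this, Set.ncard_singleton]
      exact odd_one
  have hk : ∀ j k : ZMod 4, k = j ∨ k = j + 1 ∨ k = j + 2 ∨ j = k + 1 := by decide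
  rcases hk j k with rfl | rfl | rfl | rfl
  · rfl
  · exact (h1 _ h).elim
  · exact (h2 _ h).elim
  · exact (h1 _ h.symm).elim

/-- A curve around crossings of a tangle that meets four different edges can be moved into the
tangle. -/
theorem exists_liesInside [Finite δ] {c : D.PPPPCurve} {A : Set D.Crossing} (hc : c.EdgeInjective)
    (hA : c.Tight A) {i : ZMod 4} (hAT : A ⊆ P.T i) :
    ∃ c' : D.PPPPCurve, c.StrongIsotopic c' ∧ c'.LiesInside (P.Q i) (P.T i) := by
  classical
  set b := P.Q i with hb
  set T := P.T i with hT
  have hbd : b.BoundsDisk T := P.bounds i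
  obtain ⟨hbE, hbT⟩ := hbd.edgeInjective_and_tight (P.cutSize_T i).ge
  -- Half the smallest distance, in edge coordinates, of a point of `Q i` from an end of its edge.
  obtain ⟨ε, hε, hε1, hεb⟩ : ∃ ε : ℝ, 0 < ε ∧ ε < 1 ∧ ∀ k, ε < b.pos k ∧ ε < 1 - b.pos k := by
    obtain ⟨k₀, hk₀⟩ := Finite.exists_min fun k => min (b.pos k) (1 - b.pos k)
    have h0 := b.pos_mem k₀
    have h1 : 0 < min (b.pos k₀) (1 - b.pos k₀) := lt_min h0.1 (by linarith [h0.2])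
    have h2 : min (b.pos k₀) (1 - b.pos k₀) < 1 := (min_le_left _ _).trans_lt h0.2
    refine ⟨min (b.pos k₀) (1 - b.pos k₀) / 2, by linarith, by linarith, fun k => ?_⟩
    have h3 := le_min_iff.1 (hk₀ k)
    constructor <;> linarith [h3.1, h3.2]
  have hflip : ∀ {x : ℝ}, x ∈ Set.Ioo ε (1 - ε) → 1 - x ∈ Set.Ioo ε (1 - ε) := fun {x} hx =>
    ⟨by linarith [hx.2], by linarith [hx.1]⟩
  have hbpos : ∀ k, b.pos k ∈ Set.Ioo ε (1 - ε) := fun k =>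
    ⟨(hεb k).1, by linarith [(hεb k).2]⟩
  have hbm : ∀ d u, b.Meets (d, u) → u ∈ Set.Ioo ε (1 - ε) := by
    intro d u hu
    obtain ⟨k, _, rfl⟩ := b.meets_iff.1 hu
    unfold PPPPCurve.coord
    split_ifs
    · exact hbpos k
    · exact hflip (hbpos k)
  -- Each point of `c` slides to distance `ε` from the end of its edge that lies in `A`, closer than
  -- any point of `Q i`.
  let pos : ZMod 4 → ℝ := fun k => if D.crossing (c.dart k) ∈ A then ε else 1 - ε
  have hpos : ∀ k, pos k ∈ Set.Ioo (0 : ℝ) 1 := by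
    intro k
    simp only [pos]
    split_ifs
    · exact ⟨hε, hε1⟩
    · exact ⟨by linarith, by linarith⟩
  let Near : δ × ℝ → Prop := fun p =>
    (D.crossing p.1 ∈ T ∧ p.2 = ε) ∨ (D.crossing (D.opp p.1) ∈ T ∧ p.2 = 1 - ε)
  have near_point : ∀ k, Near (c.dart k, pos k) := by
    intro k
    by_cases h : D.crossing (c.dart k) ∈ A
    · exact Or.inl ⟨hAT h, if_pos h⟩
    · refine Or.inr ⟨hAT ?_, if_neg h⟩
      by_contra h'
      exact hA (c.dart k) ⟨k, PPPPCurve.mem_hits_dart k⟩ ⟨fun h'' => absurd h'' h,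
        fun h'' => absurd h'' h'⟩
  have near_flip : ∀ p, Near p → Near (D.flip p) := by
    rintro p (⟨h1, h2⟩ | ⟨h1, h2⟩)
    · exact Or.inr ⟨by rwa [flip, D.opp_opp], by rw [flip, h2]⟩
    · exact Or.inl ⟨h1, by rw [flip, h2]; ring⟩
  have near_not_meets : ∀ p, Near p → ¬ b.Meets p := by
    rintro ⟨d, u⟩ (⟨_, rfl⟩ | ⟨_, rfl⟩) hm
    · exact lt_irrefl _ (hbm _ _ hm).1
    · exact lt_irrefl _ (hbm _ _ hm).2
  -- `Q i` runs through four different faces, so a face contains at most one of its chords, and only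
  -- the end darts of that chord leave or enter `T`.
  have huniq : ∀ k y, D.face y = D.face (D.opp (b.dart k)) →
      ¬ (D.crossing y ∈ T ↔ D.crossing (D.opp y) ∈ T) →
      y = D.opp (b.dart k) ∨ y = b.dart (k + 1) := by
    intro k y hy hcut
    obtain ⟨l, hl | hl⟩ := hbd.nonempty_hits hcut
    · right
      obtain ⟨l', rfl⟩ : ∃ l', l = l' + 1 := ⟨l - 1, by ring⟩
      rw [← hl, ← face_eq_iff.2 (b.same_face l')] at hy
      rw [← hl, P.eq_of_face_eq hbE hy]
    · left
      have hl' := D.eq_opp_iff.1 hl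
      rw [hl'] at hy
      rw [hl', P.eq_of_face_eq hbE hy]
  refine ⟨hc.move pos hpos, hc.strongIsotopic_move pos hpos, fun j k => ⟨?_, ?_, ?_⟩, fun k => ?_⟩
  · exact fun h => near_not_meets _ (near_point j) ⟨k, Or.inl h⟩
  · exact fun h => near_not_meets _ (near_point j) ⟨k, Or.inr h⟩
  · have hcut : ∀ k, ¬ (D.crossing (b.dart k) ∈ T ↔ D.crossing (D.opp (b.dart k)) ∈ T) := fun k =>
      hbT _ ⟨k, PPPPCurve.mem_hits_dart k⟩
    have hcut' : ¬ (D.crossing (D.opp (b.dart k)) ∈ T ↔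
        D.crossing (D.opp (D.opp (b.dart k))) ∈ T) := by
      rw [D.opp_opp]
      exact fun h => hcut k h.symm
    have hne : D.opp (c.dart j) ≠ c.dart (j + 1) := (hc.ne_opp _ _).symm
    have hfk : D.face (D.opp (b.dart k)) = D.face (b.dart (k + 1)) :=
      face_eq_iff.2 (b.same_face k)
    rintro (⟨h1, h2⟩ | ⟨h1, h2⟩)
    · exact not_btw_of_near hne (near_flip _ (near_point j)) (near_point (j + 1)) hε
        (hflip (hbpos k)) (hbpos (k + 1)) hcut' (huniq k) h1 h2
    · exact not_btw_of_near hne (near_flip _ (near_point j)) (near_point (j + 1)) hε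
        (hbpos (k + 1)) (hflip (hbpos k)) (hcut (k + 1))
        (fun y hy hy' => (huniq k y (hy.trans hfk.symm) hy').symm) h1 h2
  · rcases near_point k with ⟨h1, h2⟩ | ⟨h1, h2⟩
    · refine (PPPPCurve.inDisk_iff_crossing_mem fun u hu hm => ?_).2 h1
      have := (hbm _ _ hm).1
      exact lt_asymm this (hu.trans_eq h2)
    · refine (PPPPCurve.inDisk_iff_crossing_opp_mem hbd fun u hu hm => ?_).2 h1
      have := (hbm _ _ hm).2
      exact absurd (h2.symm.trans_le hu) (not_le.2 this)

/-- A curve around a single exterior crossing is not a flyping curve. -/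
theorem not_isFlypingCurve [Finite δ] {c : D.PPPPCurve} {v : D.Crossing} (hv : ∀ i, v ∉ P.T i)
    (hc : c.BoundsDisk {v}) : ¬ c.IsFlypingCurve := by
  rintro ⟨b, A, B, hA, hB, -, ⟨w, hw, rfl⟩, hne⟩
  rcases hA.eq_or_eq_compl hc with rfl | rfl
  · have hwv : w ≠ v := hw
    have hmem : ∀ i, ∀ x ∈ P.T i, x ∉ (insert w {v} : Set D.Crossing)ᶜ → x = w := by
      intro i x hx hxB
      rcases not_not.1 hxB with h | h
      · exact h
      · exact (hv i (h ▸ hx)).elim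
    -- Two tangles cannot both lie in `{w, v}`: as `v` is exterior, each would be `{w}`. If the
    -- complement of `{w, v}` lay in a tangle or were an exterior crossing, two tangles would do so.
    have hfalse : ∀ i j, i ≠ j → (∀ x ∈ P.T i, x ∉ (insert w {v} : Set D.Crossing)ᶜ) →
        ¬ ∀ x ∈ P.T j, x ∉ (insert w {v} : Set D.Crossing)ᶜ := by
      intro i j hij hi hj
      obtain ⟨x, hx⟩ := P.nonempty i
      obtain ⟨y, hy⟩ := P.nonempty j
      have hxw := hmem i x hx (hi x hx)
      have hyw := hmem j y hy (hj y hy)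
      exact hij (P.eq_of_mem (hxw ▸ hx) (hyw ▸ hy))
    have hsingle : ∀ u, (insert w {v} : Set D.Crossing) ≠ {u} := by
      intro u h
      have h1 : w ∈ ({u} : Set D.Crossing) := h ▸ Set.mem_insert w {v}
      have h2 : v ∈ ({u} : Set D.Crossing) := h ▸ Set.mem_insert_of_mem w rfl
      exact hwv (h1.trans h2.symm)
    obtain ⟨Y, rfl | rfl, ⟨i, hi⟩ | hY | hY⟩ :=
      P.exists_subset_of_cutSize_le hB.cutSize_le ⟨w, Set.mem_insert _ _⟩ hne
    · exact hv i (hi (Set.mem_insert_of_mem _ rfl))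
    · exact hsingle _ hY
    · exact hsingle _ hY
    · have hi1 : ∀ i : ZMod 4, i + 1 ≠ i := by decide
      have hi2 : ∀ i : ZMod 4, i + 2 ≠ i := by decide
      have hi3 : ∀ i : ZMod 4, i + 1 ≠ i + 2 := by decide
      exact hfalse _ _ (hi3 i) (fun x hx hxB => hi1 i (P.eq_of_mem hx (hi hxB)))
        (fun x hx hxB => hi2 i (P.eq_of_mem hx (hi hxB)))
    · refine hfalse 0 1 (by decide) (fun x hx hxB => ?_) (fun x hx hxB => ?_) <;>
      · rw [hY] at hxB
        exact P.north_notMem _ (hxB ▸ hx)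
    · refine hfalse 0 1 (by decide) (fun x hx hxB => ?_) (fun x hx hxB => ?_) <;>
      · rw [hY] at hxB
        exact P.south_notMem _ (hxB ▸ hx)
  -- Here `A` is everything except `v`, so `B` contains all crossings, and the far disk of `b`
  -- contains none.
  · obtain rfl : w = v := by simpa using hw
    obtain ⟨x, hx⟩ := hne
    exact hx (by simp [em])

end StandardPseudoMontesinos

end LinkDiagram

theorem proposition3p3 {δ : Type*} [Finite δ] (D : LinkDiagram δ)
    (P : D.StandardPseudoMontesinos) (c : D.PPPPCurve) :
    ∃ c' : D.PPPPCurve, c.StrongIsotopic c' ∧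
      ((∃ i, c'.Parallel (P.Q i)) ∨
       (∃ i, c'.LiesInside (P.Q i) (P.T i)) ∨
       (∃ v, (∀ i, v ∉ P.T i) ∧ c'.BoundsDisk {v} ∧ ¬ c'.IsFlypingCurve) ∨
       c'.BoundsDisk ∅) := by
  obtain ⟨A, hA⟩ := c.exists_boundsDisk
  rcases A.eq_empty_or_nonempty with rfl | hne
  · exact ⟨c, c.strongIsotopic_refl, Or.inr (Or.inr (Or.inr hA))⟩
  rcases Aᶜ.eq_empty_or_nonempty with he | hne'
  · exact ⟨c, c.strongIsotopic_refl, Or.inr (Or.inr (Or.inr (he ▸ hA.compl)))⟩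
  obtain ⟨Y, hY, h⟩ := P.exists_subset_of_cutSize_le hA.cutSize_le hne hne'
  have hYd : c.BoundsDisk Y := by
    rcases hY with rfl | rfl
    · exact hA
    · exact hA.compl
  have hY4 : 4 ≤ D.cutSize Y := by
    rcases hY with rfl | rfl
    · exact P.four_le_cutSize hne hne'
    · rw [LinkDiagram.cutSize_compl]
      exact P.four_le_cutSize hne hne'
  rcases h with ⟨i, hi⟩ | rfl | rfl
  · obtain ⟨hcE, hcT⟩ := hYd.edgeInjective_and_tight hY4
    obtain ⟨c', h1, h2⟩ := P.exists_liesInside hcE hcT hi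
    exact ⟨c', h1, Or.inr (Or.inl ⟨i, h2⟩)⟩
  · exact ⟨c, c.strongIsotopic_refl, Or.inr (Or.inr (Or.inl
      ⟨_, P.north_notMem, hYd, P.not_isFlypingCurve P.north_notMem hYd⟩))⟩
  · exact ⟨c, c.strongIsotopic_refl, Or.inr (Or.inr (Or.inl
      ⟨_, P.south_notMem, hYd, P.not_isFlypingCurve P.south_notMem hYd⟩))⟩
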